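/- Let $H$ be a separable complex Hilbert space and let $\{U(t)\}_{t\ge 0}$ be a Gibbs semigroup on $H$, i.e. a $C_0$-semigroup with $U(t)\in\mathcal L^1$ (trace class) for every $t>0$. Let $A$ be its generator, in the convention $U(t)=e^{-tA}$, that is, $Ax=\lim_{t\downarrow 0}t^{-1}(x-U(t)x)$ with domain $\operatorname{Dom}(A)$ the set of all $x$ for which the limit exists. Let $\|K\|_1=\sum_k s_k(K)$ denote the trace norm, $s_k(K)$ being the singular values of the compact operator $K$, and let $R_A(\lambda)=(A-\lambda)^{-1}$. Let $B$ be a (not necessarily closable) linear operator in $H$ that belongs to the Boulton–Dimoudis class $\mathcal B_1(A)$, which means: (i) $\operatorname{Dom}(B)=\operatorname{Dom}(A)$ and $B$ is relatively bounded with respect to $A$: there are $a\ge 0$, $b>0$ with $\|Bu\|\le a\|u\|+b\|Au\|$ for all $u\in\operatorname{Dom}(A)$; (ii) for every $t>0$, $B\,U(t)$ is bounded on $\operatorname{Dom}(A)$ with respect to the norm of $H$. Let $\tilde B$ be the extension of $B$ given by $\tilde Bu=\lim_{\lambda\to-\infty}|\lambda|\,B\,R_A(\lambda)u$, with domain the set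 of all $u\in H$ for which this limit exists; then $\tilde B\,U(t)$ is a bounded operator on $H$ for $t>0$, and it is required that (iii) $\int_0^1\|\tilde B\,U(s)\|\,ds<\infty$; (iv) $\tilde B\,U(t)\in\mathcal L^1$ for every $t>0$; (v) $\int_0^1\|\tilde B\,U(s)\|_1\,ds<\infty$. Then $A+B$, with domain $\operatorname{Dom}(A)$, is the generator of a $C_0$-semigroup $\{e^{-t(A+B)}\}_{t\ge0}$, this semigroup is a Gibbs semigroup, and $$\|e^{-t(A+B)}\|_1\sim\|e^{-tA}\|_1\qquad (t\downarrow 0),$$ where $f\sim g$ as $t\downarrow0$ means that $f(t)=\varphi(t)g(t)$ for all sufficiently small $t>0$, for some $\varphi$ with $\varphi(t)\to1$ as $t\downarrow0$. (For $H\neq\{0\}$ this says that $f(t)/g(t)\to1$.) -/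

import Mathlib

open Filter Topology MeasureTheory Asymptotics
open scoped ENNReal InnerProductSpace

namespace GibbsPerturbation

variable {H : Type*} [NormedAddCommGroup H] [InnerProductSpace ℂ H] [CompleteSpace H]

/-! ### Schatten classes -/

open Classical in
/-- The von Neumann–Schatten norm `‖K‖_p = (∑ₖ sₖ(K) ^ p) ^ (1 / p)`, with values in `[0, ∞]`.
The singular values `sₖ(K)` are the square roots of the nonzero eigenvalues of `K* K`, counted with
multiplicity; so each `μ > 0` contributes `dim ker (K* K - μ)` many terms `√μ ^ p`.
The norm is `∞` if `K` is not compact. -/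
noncomputable def schattenNorm (p : ℝ) (K : H →L[ℂ] H) : ℝ≥0∞ :=
  if IsCompactOperator K then
    (∑' μ : {μ : ℝ // 0 < μ},
      (Module.finrank ℂ (Module.End.eigenspace
          ((ContinuousLinearMap.adjoint K ∘L K : H →L[ℂ] H) : Module.End ℂ H) ((μ : ℝ) : ℂ)) : ℝ≥0∞)
        * ENNReal.ofReal (Real.sqrt μ) ^ p) ^ (1 / p)
  else ⊤

/-- The Schatten class `ℒ^p`: compact operators with `‖K‖_p < ∞`. -/
def IsSchatten (p : ℝ) (K : H →L[ℂ] H) : Prop :=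
  schattenNorm p K < ⊤

/-- The trace norm `‖K‖_1` as a real number (meaningful for `K ∈ ℒ^1`). -/
noncomputable def traceNorm (K : H →L[ℂ] H) : ℝ :=
  (schattenNorm 1 K).toReal

/-! ### Semigroups and their generators -/

/-- `{U(t)}_{t ≥ 0}` is a `C₀`-semigroup of bounded operators. Values of `U` at negative
times are irrelevant. -/
structure IsC0Semigroup (U : ℝ → H →L[ℂ] H) : Prop where
  map_zero : U 0 = ContinuousLinearMap.id ℂ H
  map_add : ∀ s t : ℝ, 0 ≤ s → 0 ≤ t → U (s + t) = U s ∘L U t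
  tendsto_zero : ∀ x : H, Tendsto (fun t : ℝ => U t x) (𝓝[>] 0) (𝓝 x)

/-- `A` is the generator of `U`, in the convention `U(t) = e^{-tA}`: a vector `x` lies in the domain
of `A`, with `A x = y`, if and only if `(x - U(t) x) / t → y` as `t ↓ 0`. -/
def IsGenerator (A : H →ₗ.[ℂ] H) (U : ℝ → H →L[ℂ] H) : Prop :=
  ∀ x y : H, (x, y) ∈ A.graph ↔
    Tendsto (fun t : ℝ => ((t⁻¹ : ℝ) : ℂ) • (x - U t x)) (𝓝[>] 0) (𝓝 y)

/-- A Gibbs semigroup: a `C₀`-semigroup with `U(t) ∈ ℒ^1` for all `t > 0`. -/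
structure IsGibbsSemigroup (U : ℝ → H →L[ℂ] H) : Prop where
  isC0Semigroup : IsC0Semigroup U
  isSchatten : ∀ t : ℝ, 0 < t → IsSchatten 1 (U t)

/-! ### Resolvents and the extension of a perturbation -/

/-- `R` is the bounded inverse `(A - z)⁻¹`. -/
def IsResolventAt (A : H →ₗ.[ℂ] H) (z : ℂ) (R : H →L[ℂ] H) : Prop :=
  (∀ x : H, (R x, x + z • R x) ∈ A.graph) ∧ ∀ u : A.domain, R (A u - z • (u : H)) = u

/-- The resolvent set `ρ(A)`. -/
def resolventSet (A : H →ₗ.[ℂ] H) : Set ℂ :=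
  {z | ∃ R : H →L[ℂ] H, IsResolventAt A z R}

open Classical in
/-- The resolvent `R_A(z) = (A - z)⁻¹` for `z ∈ ρ(A)` (and `0` for other `z`). -/
noncomputable def resolvent (A : H →ₗ.[ℂ] H) (z : ℂ) : H →L[ℂ] H :=
  if h : ∃ R : H →L[ℂ] H, IsResolventAt A z R then h.choose else 0

open Classical in
/-- The everywhere defined operator `B R_A(z)`; it makes sense when `R_A(z)` maps into the domain of
`B`, in particular when `z ∈ ρ(A)` and `Dom B = Dom A` (otherwise it is set to `0`). -/
noncomputable def compResolvent (A B : H →ₗ.[ℂ] H) (z : ℂ) : H →ₗ[ℂ] H :=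
  if h : ∀ x : H, resolvent A z x ∈ B.domain then
    B.toFun ∘ₗ LinearMap.codRestrict B.domain (resolvent A z : H →ₗ[ℂ] H) h
  else 0

/-- The relation `lim_{λ → -∞} |λ| B R_A(λ) u = y`, with `λ` real. -/
def IsExtValue (A B : H →ₗ.[ℂ] H) (u y : H) : Prop :=
  Tendsto (fun l : ℝ => ((|l| : ℝ) : ℂ) • compResolvent A B (l : ℂ) u) atBot (𝓝 y)

/-- The extension `B̃` of `B`: its domain is the set of `u` for which
`lim_{λ → -∞} |λ| B R_A(λ) u` exists, and its value at `u` is this limit. -/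
noncomputable def ext (A B : H →ₗ.[ℂ] H) : H →ₗ.[ℂ] H where
  domain :=
    { carrier := {u | ∃ y, IsExtValue A B u y}
      add_mem' := by
        rintro u v ⟨y, hy⟩ ⟨z, hz⟩
        exact ⟨y + z, by simpa [IsExtValue] using hy.add hz⟩
      zero_mem' := ⟨0, by simp [IsExtValue]⟩
      smul_mem' := by
        rintro c u ⟨y, hy⟩
        exact ⟨c • y, by simpa [IsExtValue, smul_comm c] using hy.const_smul c⟩ }
  toFun :=
    { toFun := fun u => u.2.choose
      map_add' := fun u v => tendsto_nhds_unique (u + v).2.choose_spec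
        (by simpa using u.2.choose_spec.add v.2.choose_spec)
      map_smul' := fun c u => tendsto_nhds_unique (c • u).2.choose_spec
        (by simpa [smul_comm c] using u.2.choose_spec.const_smul c) }

theorem mem_graph_ext_iff {A B : H →ₗ.[ℂ] H} {u y : H} :
    (u, y) ∈ (ext A B).graph ↔ IsExtValue A B u y := by
  rw [LinearPMap.mem_graph_iff]
  constructor
  · rintro ⟨v, rfl, rfl⟩
    exact v.2.choose_spec
  · intro h
    refine ⟨⟨u, y, h⟩, rfl, ?_⟩
    exact tendsto_nhds_unique (⟨u, y, h⟩ : (ext A B).domain).2.choose_spec h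

/-! ### The class of perturbations -/

/-- The Boulton–Dimoudis class `ℬ_p(A)`, where `U(t) = e^{-tA}`. The operator `B` need not be
closable. In the last condition `T t` is the bounded operator `B̃ U(t)`, defined on all of `H`. -/
structure MemClass (p : ℝ) (A : H →ₗ.[ℂ] H) (U : ℝ → H →L[ℂ] H) (B : H →ₗ.[ℂ] H) : Prop where
  /-- `B` has the same domain as `A`. -/
  domain_eq : B.domain = A.domain
  /-- `B` is relatively bounded with respect to `A`. -/
  relBounded : ∃ a b : ℝ, 0 ≤ a ∧ 0 < b ∧ ∀ u v w : H,
    (u, v) ∈ A.graph → (u, w) ∈ B.graph → ‖w‖ ≤ a * ‖u‖ + b * ‖v‖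
  /-- `B U(t)` is bounded on the domain of `A`, for every `t > 0`. -/
  bounded : ∀ t : ℝ, 0 < t → ∃ C : ℝ, ∀ u ∈ A.domain, ∃ w : H,
    (U t u, w) ∈ B.graph ∧ ‖w‖ ≤ C * ‖u‖
  /-- `B̃ U(t)` lies in `ℒ^p` for `t > 0`, and its operator norm and its `p`-norm are integrable
  over `(0, 1)`. -/
  integrable : ∃ T : ℝ → H →L[ℂ] H,
    (∀ t : ℝ, 0 < t → ∀ x : H, (U t x, T t x) ∈ (ext A B).graph) ∧
    (∫⁻ s in Set.Ioo (0 : ℝ) 1, ‖T s‖ₑ) < ⊤ ∧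
    (∀ t : ℝ, 0 < t → IsSchatten p (T t)) ∧
    (∫⁻ s in Set.Ioo (0 : ℝ) 1, schattenNorm p (T s)) < ⊤

end GibbsPerturbation

/-!
`V(t) = e^{-t(A + B)}` is constructed as the solution of the Volterra equation `V = U - V ∗ T`,
where `T(t) = B̃ U(t)` and `(V ∗ T)(t) = ∫₀ᵗ V(t - s) T(s) ds`. Since `U(t)` is compact for `t > 0`,
the semigroup `U` is norm continuous on `(0, ∞)`, and so is `T` because `T(s + t) = T(s) U(t)`. Hence
all integrals are Bochner integrals of operators. After multiplication by `e^{-l t}` with `l` large,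
`T` has `L¹`-norm less than `1` on `(0, ∞)`, and the equation is solved by a contraction
(`exists_eq_sub_volterra`). The semigroup law holds because `s ↦ V(t + s) - V(t) V(s)` solves the
homogeneous equation (`mul_of_eq_sub_volterra`).

The generator of `V` extends `A + B`: on `Dom(A)` one has `T(t) x = B U(t) x → B x`, so the mean of
`V(t - s) T(s) x` over `(0, t)` tends to `B x` (`hasGenValue_of_eq_sub_volterra`). It is not larger,
because `B (A + l)⁻¹ = ∫₀^∞ e^{-l t} T(t) dt` has norm less than `1` (`mem_graph_laplace`), so that
`A + B + l` is surjective by a Neumann series, while the generator of `V` plus `l` is injective.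
As a semigroup is determined by its densely defined generator (`eq_of_hasGenValue_imp`), every `V`
as in the statement is the one constructed.

For the trace norm of a compact operator `K`, the spectral theorem for `K* K` gives an orthonormal
basis `b` with `‖K‖₁ = ∑ ‖K bᵢ‖` and pairwise orthogonal vectors `K bᵢ`
(`exists_hilbertBasis_schattenNorm_eq`). By this, `‖K‖₁` is the maximum of `∑ |⟪hᵢ, K gᵢ⟫|` over
orthonormal families `g`, `h`, which yields the triangle inequality, the left ideal property and
`‖∫ F‖₁ ≤ ∫ ‖F‖₁`. The Volterra equation now shows
`‖V(t) - U(t)‖₁ ≤ C ∫₀ᵗ ‖T(s)‖₁ ds → 0`, and `‖U(t)‖₁ ≥ ‖U(t)‖` is bounded below as `t ↓ 0`.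
-/

set_option linter.unusedSectionVars false

namespace GibbsPerturbation

/-! ### The Volterra equation `v = u - v ∗ τ` in a Banach algebra -/

section Volterra

variable {𝓐 : Type*} [NormedRing 𝓐]

theorem aestronglyMeasurable_indicator_sub {v : ℝ → 𝓐} (hv : ContinuousOn v (Set.Ioi 0)) (t : ℝ) :
    AEStronglyMeasurable (fun s => (Set.Ioi (0 : ℝ)).indicator v (t - s)) := by
  have h : AEStronglyMeasurable ((Set.Ioi (0 : ℝ)).indicator v) :=
    (aestronglyMeasurable_indicator_iff measurableSet_Ioi).2
      (hv.aestronglyMeasurable measurableSet_Ioi)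
  exact h.comp_measurePreserving (Measure.measurePreserving_sub_left volume t)

theorem norm_indicator_Ioi_le {v : ℝ → 𝓐} {C : ℝ} (hC : 0 ≤ C) (hvC : ∀ t, 0 < t → ‖v t‖ ≤ C)
    (t : ℝ) : ‖(Set.Ioi (0 : ℝ)).indicator v t‖ ≤ C := by
  by_cases h : 0 < t
  · rw [Set.indicator_of_mem (show t ∈ Set.Ioi (0 : ℝ) from h)]; exact hvC t h
  · rw [Set.indicator_of_notMem (show t ∉ Set.Ioi (0 : ℝ) from h)]; simpa

theorem integrableOn_indicator_mul {v τ : ℝ → 𝓐} {C : ℝ} (hC : 0 ≤ C)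
    (hv : ContinuousOn v (Set.Ioi 0)) (hvC : ∀ t, 0 < t → ‖v t‖ ≤ C)
    (hτ : IntegrableOn τ (Set.Ioi 0)) (t : ℝ) :
    IntegrableOn (fun s => (Set.Ioi (0 : ℝ)).indicator v (t - s) * τ s) (Set.Ioi 0) :=
  hτ.bdd_mul (c := C) (aestronglyMeasurable_indicator_sub hv t).restrict
    (ae_of_all _ fun _ => norm_indicator_Ioi_le hC hvC _)

theorem indicator_mul_eq (v τ : ℝ → 𝓐) (t s : ℝ) :
    (Set.Ioi (0 : ℝ)).indicator v (t - s) * τ s =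
      (Set.Iio t).indicator (fun s => v (t - s) * τ s) s := by
  by_cases h : s < t
  · rw [Set.indicator_of_mem (show t - s ∈ Set.Ioi (0 : ℝ) by simpa using h),
      Set.indicator_of_mem (show s ∈ Set.Iio t from h)]
  · rw [Set.indicator_of_notMem (show t - s ∉ Set.Ioi (0 : ℝ) by simpa using h),
      Set.indicator_of_notMem (show s ∉ Set.Iio t from h), zero_mul]

theorem integrableOn_volterra {v τ : ℝ → 𝓐} {C : ℝ}
    (hv : ContinuousOn v (Set.Ioi 0)) (hvC : ∀ t, 0 < t → ‖v t‖ ≤ C)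
    (hτ : IntegrableOn τ (Set.Ioi 0)) (t : ℝ) :
    IntegrableOn (fun s => v (t - s) * τ s) (Set.Ioo 0 t) := by
  have hC : 0 ≤ C := (norm_nonneg _).trans (hvC 1 one_pos)
  have h := integrableOn_indicator_mul hC hv hvC hτ t
  simp_rw [indicator_mul_eq] at h
  rw [IntegrableOn, integrable_indicator_iff measurableSet_Iio, IntegrableOn,
    Measure.restrict_restrict measurableSet_Iio] at h
  rwa [Set.inter_comm, Set.Ioi_inter_Iio] at h

variable [NormedAlgebra ℝ 𝓐]

/-- The convolution `(v ∗ τ)(t) = ∫₀ᵗ v(t - s) τ(s) ds` of functions on `(0, ∞)` with values in a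
Banach algebra. -/
noncomputable def volterra (v τ : ℝ → 𝓐) (t : ℝ) : 𝓐 :=
  ∫ s in Set.Ioo 0 t, v (t - s) * τ s

theorem volterra_eq_indicator (v τ : ℝ → 𝓐) (t : ℝ) :
    volterra v τ t = ∫ s in Set.Ioi 0, (Set.Ioi (0 : ℝ)).indicator v (t - s) * τ s := by
  simp_rw [indicator_mul_eq]
  rw [setIntegral_indicator measurableSet_Iio, Set.Ioi_inter_Iio, volterra]

theorem norm_volterra_le {v τ : ℝ → 𝓐} {C : ℝ} (hvC : ∀ t, 0 < t → ‖v t‖ ≤ C)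
    (hτ : IntegrableOn τ (Set.Ioi 0)) (t : ℝ) :
    ‖volterra v τ t‖ ≤ C * ∫ s in Set.Ioo 0 t, ‖τ s‖ := by
  rw [← integral_const_mul]
  refine norm_integral_le_of_norm_le
    ((hτ.mono_set Set.Ioo_subset_Ioi_self).norm.const_mul C) ?_
  refine (ae_restrict_iff' measurableSet_Ioo).2 (ae_of_all _ fun s hs => ?_)
  exact (norm_mul_le _ _).trans
    (mul_le_mul_of_nonneg_right (hvC _ (sub_pos.2 hs.2)) (norm_nonneg _))

theorem norm_volterra_le_Ioi {v τ : ℝ → 𝓐} {C : ℝ} (hvC : ∀ t, 0 < t → ‖v t‖ ≤ C)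
    (hτ : IntegrableOn τ (Set.Ioi 0)) (t : ℝ) :
    ‖volterra v τ t‖ ≤ C * ∫ s in Set.Ioi 0, ‖τ s‖ := by
  refine (norm_volterra_le hvC hτ t).trans (mul_le_mul_of_nonneg_left ?_
    ((norm_nonneg _).trans (hvC 1 one_pos)))
  exact setIntegral_mono_set hτ.norm (ae_of_all _ fun _ => norm_nonneg _)
    Set.Ioo_subset_Ioi_self.eventuallyLE

theorem continuous_volterra {v τ : ℝ → 𝓐} {C : ℝ}
    (hv : ContinuousOn v (Set.Ioi 0)) (hvC : ∀ t, 0 < t → ‖v t‖ ≤ C)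
    (hτ : IntegrableOn τ (Set.Ioi 0)) : Continuous (volterra v τ) := by
  have hC : 0 ≤ C := (norm_nonneg _).trans (hvC 1 one_pos)
  rw [continuous_iff_continuousAt]
  intro t
  rw [show volterra v τ = fun t => ∫ s in Set.Ioi 0,
    (Set.Ioi (0 : ℝ)).indicator v (t - s) * τ s from funext (volterra_eq_indicator v τ)]
  refine continuousAt_of_dominated (bound := fun s => C * ‖τ s‖)
    (Eventually.of_forall fun t => (integrableOn_indicator_mul hC hv hvC hτ t).1)
    (Eventually.of_forall fun t => ae_of_all _ fun s => (norm_mul_le _ _).trans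
      (mul_le_mul_of_nonneg_right (norm_indicator_Ioi_le hC hvC _) (norm_nonneg _)))
    (hτ.norm.const_mul C) ?_
  -- The extension of `v` by zero is continuous except at `0`.
  have h0 : ∀ᵐ s : ℝ, s ≠ t := by simp [ae_iff]
  refine ae_restrict_of_ae (h0.mono fun s hs => ?_)
  refine ContinuousAt.mul ?_ continuousAt_const
  have hsub : ContinuousAt (fun r : ℝ => r - s) t := by fun_prop
  refine ContinuousAt.comp (g := (Set.Ioi (0 : ℝ)).indicator v) (f := fun r : ℝ => r - s) ?_ hsub
  rcases lt_or_gt_of_ne hs with h | h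
  · have hm : Set.Ioi (0 : ℝ) ∈ 𝓝 (t - s) := Ioi_mem_nhds (sub_pos.2 h)
    exact (hv.continuousAt hm).congr
      (by filter_upwards [hm] with r hr; rw [Set.indicator_of_mem hr])
  · have hm : Set.Iio (0 : ℝ) ∈ 𝓝 (t - s) := Iio_mem_nhds (sub_neg.2 h)
    refine (continuousAt_const (y := (0 : 𝓐))).congr ?_
    filter_upwards [hm] with r hr
    rw [Set.indicator_of_notMem (by simpa using le_of_lt hr)]

/-- If `∫ ‖τ‖ < 1` then the only bounded solution of `w = - w ∗ τ` is zero. -/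
theorem eq_zero_of_eq_neg_volterra {w τ : ℝ → 𝓐} {C : ℝ}
    (hwC : ∀ t, 0 < t → ‖w t‖ ≤ C) (hτ : IntegrableOn τ (Set.Ioi 0))
    (hq : ∫ s in Set.Ioi 0, ‖τ s‖ < 1)
    (hw : ∀ t, 0 < t → w t = - volterra w τ t) : ∀ t, 0 < t → w t = 0 := by
  set q := ∫ s in Set.Ioi 0, ‖τ s‖ with hq_def
  have hq0 : 0 ≤ q := integral_nonneg fun _ => norm_nonneg _
  have key : ∀ n : ℕ, ∀ t, 0 < t → ‖w t‖ ≤ C * q ^ n := by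
    intro n
    induction n with
    | zero => simpa using hwC
    | succ n ih =>
      intro t ht
      rw [hw t ht, norm_neg, pow_succ, ← mul_assoc]
      exact norm_volterra_le_Ioi ih hτ t
  intro t ht
  have hlim : Tendsto (fun n : ℕ => C * q ^ n) atTop (𝓝 (C * 0)) :=
    (tendsto_pow_atTop_nhds_zero_of_lt_one hq0 hq).const_mul C
  rw [mul_zero] at hlim
  exact norm_le_zero_iff.1 (ge_of_tendsto' hlim fun n => key n t ht)

/-- Existence for the Volterra equation, by the contraction principle in the space of bounded
continuous functions on `(0, ∞)`. -/
theorem exists_eq_sub_volterra [CompleteSpace 𝓐] {u τ : ℝ → 𝓐} {M : ℝ}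
    (hu : ContinuousOn u (Set.Ioi 0)) (huM : ∀ t, 0 < t → ‖u t‖ ≤ M)
    (hτ : IntegrableOn τ (Set.Ioi 0)) (hq : ∫ s in Set.Ioi 0, ‖τ s‖ < 1) :
    ∃ v : ℝ → 𝓐, ContinuousOn v (Set.Ioi 0) ∧ (∃ C, ∀ t, 0 < t → ‖v t‖ ≤ C) ∧
      ∀ t, 0 < t → v t = u t - volterra v τ t := by
  let E := BoundedContinuousFunction (Set.Ioi (0 : ℝ)) 𝓐
  let e : E → ℝ → 𝓐 := fun f t => if h : 0 < t then f ⟨t, h⟩ else 0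
  have he : ∀ (f : E) (t : Set.Ioi (0 : ℝ)), e f t = f t := fun f t => dif_pos t.2
  have hec : ∀ f : E, ContinuousOn (e f) (Set.Ioi 0) := by
    intro f
    rw [continuousOn_iff_continuous_domRestrict]
    exact f.continuous.congr fun t => (he f t).symm
  have heb : ∀ (f : E) t, 0 < t → ‖e f t‖ ≤ ‖f‖ := fun f t ht => by
    rw [he f ⟨t, ht⟩]; exact f.norm_coe_le_norm _
  let Φ : E → E := fun f => BoundedContinuousFunction.ofNormedAddCommGroup
    (fun t : Set.Ioi (0 : ℝ) => u t - volterra (e f) τ t)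
    ((continuousOn_iff_continuous_domRestrict.1 hu).sub
      ((continuous_volterra (hec f) (heb f) hτ).comp continuous_subtype_val))
    (M + ‖f‖ * ∫ s in Set.Ioi 0, ‖τ s‖)
    (fun t => (norm_sub_le _ _).trans
      (add_le_add (huM t t.2) (norm_volterra_le_Ioi (heb f) hτ t)))
  have hq0 : 0 ≤ ∫ s in Set.Ioi 0, ‖τ s‖ := integral_nonneg fun _ => norm_nonneg _
  have hΦ : ContractingWith ⟨_, hq0⟩ Φ := by
    refine ⟨by exact_mod_cast hq, LipschitzWith.of_dist_le_mul fun f g => ?_⟩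
    rw [BoundedContinuousFunction.dist_le (by positivity)]
    intro t
    rw [dist_eq_norm, dist_eq_norm]
    have h1 : Φ f t - Φ g t = - volterra (e (f - g)) τ t := by
      change u t - volterra (e f) τ t - (u t - volterra (e g) τ t) = _
      have : volterra (e (f - g)) τ t = volterra (e f) τ t - volterra (e g) τ t := by
        rw [volterra, volterra, volterra, ← integral_sub (integrableOn_volterra (hec f) (heb f) hτ t)
          (integrableOn_volterra (hec g) (heb g) hτ t)]
        refine setIntegral_congr_fun measurableSet_Ioo fun s hs => ?_
        have hs' : 0 < (t : ℝ) - s := sub_pos.2 hs.2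
        simp only [e, dif_pos hs', ← sub_mul]
        rfl
      rw [this]; abel
    rw [h1, norm_neg, mul_comm]
    exact norm_volterra_le_Ioi (heb _) hτ t
  have hfix : Φ (hΦ.fixedPoint Φ) = hΦ.fixedPoint Φ := hΦ.fixedPoint_isFixedPt
  set f := hΦ.fixedPoint Φ
  refine ⟨e f, hec f, ⟨_, heb f⟩, fun t ht => ?_⟩
  have := DFunLike.congr_fun hfix ⟨t, ht⟩
  rw [he f ⟨t, ht⟩, ← this]
  rfl

/-- The semigroup law passes from `u` to the solution of `v = u - v ∗ τ`: for fixed `t`, the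
difference `s ↦ v (t + s) - v t * v s` solves the homogeneous equation. -/
theorem mul_of_eq_sub_volterra {u τ v : ℝ → 𝓐} {C : ℝ}
    (hu : ∀ s t, 0 < s → 0 < t → u (s + t) = u s * u t)
    (hτu : ∀ s t, 0 < s → 0 < t → τ (s + t) = τ s * u t)
    (hτ : IntegrableOn τ (Set.Ioi 0)) (hq : ∫ s in Set.Ioi 0, ‖τ s‖ < 1)
    (hv : ContinuousOn v (Set.Ioi 0)) (hvC : ∀ t, 0 < t → ‖v t‖ ≤ C)
    (hvu : ∀ t, 0 < t → v t = u t - volterra v τ t) (t s : ℝ) (ht : 0 < t) (hs : 0 < s) :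
    v (t + s) = v t * v s := by
  have hC : 0 ≤ C := (norm_nonneg _).trans (hvC 1 one_pos)
  have hI := fun t => integrableOn_volterra hv hvC hτ t
  -- Cut the integral defining `v (t + s)` at `s`.
  have h1 : ∀ s, 0 < s → v (t + s) = v t * u s - ∫ r in Set.Ioo 0 s, v (t + s - r) * τ r := by
    intro s hs
    have hsub : ∫ r in Set.Ioo s (t + s), v (t + s - r) * τ r = volterra v τ t * u s := by
      rw [volterra, ← integral_mul_const_of_integrable (hI t)]
      have hpre : (fun r => r + s) ⁻¹' Set.Ioo s (t + s) = Set.Ioo 0 t := by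
        ext r; simp
      rw [← (measurePreserving_add_right volume s).setIntegral_preimage_emb
        (measurableEmbedding_addRight s), hpre]
      refine setIntegral_congr_fun measurableSet_Ioo fun r hr => ?_
      rw [hτu r s hr.1 hs, mul_assoc]
      congr 2
      ring
    have hsplit : volterra v τ (t + s) = (∫ r in Set.Ioo 0 s, v (t + s - r) * τ r) +
        ∫ r in Set.Ioo s (t + s), v (t + s - r) * τ r := by
      have hun : Set.Ioo 0 (t + s) = Set.Ioo 0 s ∪ Set.Ico s (t + s) :=
        (Set.Ioo_union_Ico_eq_Ioo hs (by linarith)).symm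
      have hI' := hI (t + s)
      rw [hun] at hI'
      rw [volterra, hun, setIntegral_union _ measurableSet_Ico hI'.left_of_union
        hI'.right_of_union, integral_Ico_eq_integral_Ioo]
      exact Set.disjoint_left.2 fun r hr hr' => absurd hr.2 (not_lt.2 hr'.1)
    rw [hvu _ (by linarith), hu t s ht hs, hsplit, hsub, hvu t ht, sub_mul]
    abel
  have h2 : ∀ s, 0 < s → v (t + s) - v t * v s = 0 := by
    refine eq_zero_of_eq_neg_volterra (w := fun s => v (t + s) - v t * v s) (C := C + C * C) ?_ hτ hq ?_
    · intro s hs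
      refine (norm_sub_le _ _).trans (add_le_add (hvC _ (by linarith)) ?_)
      exact (norm_mul_le _ _).trans (mul_le_mul (hvC t ht) (hvC s hs) (norm_nonneg _) hC)
    · intro s hs
      have e1 : IntegrableOn (fun r => v (t + s - r) * τ r) (Set.Ioo 0 s) :=
        (hI (t + s)).mono_set (Set.Ioo_subset_Ioo_right (by linarith))
      have e2 : IntegrableOn (fun r => v t * (v (s - r) * τ r)) (Set.Ioo 0 s) :=
        (hI s).const_mul (v t)
      have e3 : volterra (fun s => v (t + s) - v t * v s) τ s =
          (∫ r in Set.Ioo 0 s, v (t + s - r) * τ r) - v t * volterra v τ s := by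
        rw [volterra, volterra, ← integral_const_mul_of_integrable (hI s), ← integral_sub e1 e2]
        refine setIntegral_congr_fun measurableSet_Ioo fun r _ => ?_
        simp only [sub_mul, mul_assoc, add_sub_assoc]
      simp only [e3]
      rw [h1 s hs, hvu s hs, mul_sub]
      have : volterra v τ s = u s - v s := by rw [hvu s hs]; abel
      abel
  exact sub_eq_zero.1 (h2 s hs)

end Volterra

/-! ### `C₀`-semigroups: growth, continuity, generators -/

section Semigroup

variable {H : Type*} [NormedAddCommGroup H] [InnerProductSpace ℂ H]

/-- `y = lim (x - U(t) x) / t` as `t ↓ 0`, that is, `x` lies in the domain of the generator of `U`,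
which maps it to `y`. -/
def HasGenValue (U : ℝ → H →L[ℂ] H) (x y : H) : Prop :=
  Tendsto (fun t : ℝ => t⁻¹ • (x - U t x)) (𝓝[>] 0) (𝓝 y)

/-- The rescaled family `e^{-l t} U(t)`. -/
noncomputable def rescale (l : ℝ) (U : ℝ → H →L[ℂ] H) (t : ℝ) : H →L[ℂ] H :=
  Real.exp (-(l * t)) • U t

theorem rescale_apply (l : ℝ) (U : ℝ → H →L[ℂ] H) (t : ℝ) (x : H) :
    rescale l U t x = Real.exp (-(l * t)) • U t x := rfl

theorem rescale_neg_rescale (l : ℝ) (U : ℝ → H →L[ℂ] H) : rescale (-l) (rescale l U) = U := by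
  ext t x
  rw [rescale_apply, rescale_apply, smul_smul, ← Real.exp_add]
  simp

theorem norm_rescale (l : ℝ) (U : ℝ → H →L[ℂ] H) (t : ℝ) :
    ‖rescale l U t‖ = Real.exp (-(l * t)) * ‖U t‖ := by
  rw [rescale, norm_smul, Real.norm_eq_abs, abs_of_pos (Real.exp_pos _)]

theorem continuousOn_rescale {U : ℝ → H →L[ℂ] H} {s : Set ℝ} (hU : ContinuousOn U s) (l : ℝ) :
    ContinuousOn (rescale l U) s :=
  ContinuousOn.smul (f := fun t => Real.exp (-(l * t))) (by fun_prop) hU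

theorem rescale_add {T U : ℝ → H →L[ℂ] H} {s t : ℝ} (h : T (s + t) = T s * U t) (l : ℝ) :
    rescale l T (s + t) = rescale l T s * rescale l U t := by
  rw [rescale, rescale, rescale, h, smul_mul_smul_comm, ← Real.exp_add]
  ring_nf

theorem tendsto_inv_mul_one_sub_exp (l : ℝ) :
    Tendsto (fun t : ℝ => t⁻¹ * (1 - Real.exp (-(l * t)))) (𝓝[>] 0) (𝓝 l) := by
  have h1 : HasDerivAt (fun t : ℝ => 1 - Real.exp (-(l * t))) l 0 := by
    have h := (((hasDerivAt_id (0 : ℝ)).const_mul l).neg.exp).const_sub 1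
    simpa using h
  have h2 := h1.tendsto_slope_zero_right
  simpa using h2

theorem HasGenValue.rescale {U : ℝ → H →L[ℂ] H} {x y : H} (h : HasGenValue U x y) (l : ℝ) :
    HasGenValue (rescale l U) x (y + l • x) := by
  have h1 : Tendsto (fun t : ℝ => Real.exp (-(l * t))) (𝓝[>] 0) (𝓝 1) := by
    have : Continuous fun t : ℝ => Real.exp (-(l * t)) := by fun_prop
    simpa using (this.tendsto 0).mono_left nhdsWithin_le_nhds
  have h2 := (h1.smul h).add ((tendsto_inv_mul_one_sub_exp l).smul_const x)
  rw [one_smul] at h2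
  refine h2.congr fun t => ?_
  rw [rescale_apply]
  module

theorem hasGenValue_rescale_iff {U : ℝ → H →L[ℂ] H} {x y : H} {l : ℝ} :
    HasGenValue (rescale l U) x (y + l • x) ↔ HasGenValue U x y := by
  refine ⟨fun h => ?_, fun h => h.rescale l⟩
  have := h.rescale (-l)
  rw [rescale_neg_rescale] at this
  simpa using this

theorem IsGenerator.mem_graph_iff {A : H →ₗ.[ℂ] H} {U : ℝ → H →L[ℂ] H} (hA : IsGenerator A U)
    {x y : H} : (x, y) ∈ A.graph ↔ HasGenValue U x y := by
  rw [hA x y, HasGenValue]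
  simp only [Complex.coe_smul]

theorem isGenerator_iff {A : H →ₗ.[ℂ] H} {U : ℝ → H →L[ℂ] H} :
    IsGenerator A U ↔ ∀ x y, (x, y) ∈ A.graph ↔ HasGenValue U x y := by
  refine ⟨fun h x y => h.mem_graph_iff, fun h x y => ?_⟩
  rw [h x y, HasGenValue]
  simp only [Complex.coe_smul]

theorem HasGenValue.sub {U : ℝ → H →L[ℂ] H} {x y x' y' : H} (h : HasGenValue U x y)
    (h' : HasGenValue U x' y') : HasGenValue U (x - x') (y - y') := by
  refine (Tendsto.sub h h').congr fun t => ?_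
  rw [map_sub]
  module

theorem HasGenValue.map {U : ℝ → H →L[ℂ] H} {x y : H} (h : HasGenValue U x y) (S : H →L[ℂ] H)
    (hS : ∀ t, 0 < t → S * U t = U t * S) : HasGenValue U (S x) (S y) := by
  refine ((S.continuous.tendsto y).comp h).congr' ?_
  filter_upwards [self_mem_nhdsWithin] with t ht
  have : S (U t x) = U t (S x) := DFunLike.congr_fun (hS t ht) x
  simp only [Function.comp_apply, map_sub, this,
    S.map_smul_of_tower]

theorem isC0Semigroup_id : IsC0Semigroup fun _ => ContinuousLinearMap.id ℂ H :=
  ⟨rfl, fun _ _ _ _ => rfl, fun _ => tendsto_const_nhds⟩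

theorem hasGenValue_id (x : H) : HasGenValue (fun _ => ContinuousLinearMap.id ℂ H) x 0 := by
  simp [HasGenValue]

/-- If `F t s` is close to `w` for `0 < s < t` and small `t`, then so is the mean of `F t` over
`(0, t)`. -/
theorem tendsto_inv_smul_setIntegral [CompleteSpace H] {F : ℝ → ℝ → H} {w : H}
    (hF : ∀ᶠ t in 𝓝[>] (0 : ℝ), IntegrableOn (F t) (Set.Ioo 0 t))
    (h : ∀ ε > 0, ∀ᶠ t in 𝓝[>] (0 : ℝ), ∀ s ∈ Set.Ioo 0 t, ‖F t s - w‖ ≤ ε) :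
    Tendsto (fun t : ℝ => t⁻¹ • ∫ s in Set.Ioo 0 t, F t s) (𝓝[>] 0) (𝓝 w) := by
  rw [Metric.tendsto_nhds]
  intro ε hε
  filter_upwards [hF, h (ε / 2) (by positivity), self_mem_nhdsWithin] with t hFt ht ht0
  have ht0 : 0 < t := ht0
  have h1 : t⁻¹ • ∫ s in Set.Ioo 0 t, F t s - w =
      t⁻¹ • (∫ s in Set.Ioo 0 t, F t s) - w := by
    rw [integral_sub hFt (by simp), setIntegral_const]
    simp [smul_sub, smul_smul, ht0.le, ht0.ne']
  rw [dist_eq_norm, ← h1, norm_smul, norm_inv, Real.norm_eq_abs, abs_of_pos ht0]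
  have h2 : ‖∫ s in Set.Ioo 0 t, (F t s - w)‖ ≤ ε / 2 * (volume (Set.Ioo 0 t)).toReal :=
    norm_setIntegral_le_of_norm_le_const (by simp) ht
  rw [Real.volume_Ioo, sub_zero, ENNReal.toReal_ofReal ht0.le] at h2
  calc t⁻¹ * ‖∫ s in Set.Ioo 0 t, (F t s - w)‖ ≤ t⁻¹ * (ε / 2 * t) := by gcongr
    _ = ε / 2 := by field_simp
    _ < ε := by linarith

namespace IsC0Semigroup

variable {U V W : ℝ → H →L[ℂ] H}

theorem map_add_mul (hU : IsC0Semigroup U) {s t : ℝ} (hs : 0 ≤ s) (ht : 0 ≤ t) :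
    U (s + t) = U s * U t := hU.map_add s t hs ht

theorem commute (hU : IsC0Semigroup U) {s t : ℝ} (hs : 0 ≤ s) (ht : 0 ≤ t) :
    U s * U t = U t * U s := by
  rw [← hU.map_add_mul hs ht, ← hU.map_add_mul ht hs, add_comm]

theorem rescale (hU : IsC0Semigroup U) (l : ℝ) : IsC0Semigroup (rescale l U) := by
  refine ⟨?_, fun s t hs ht => rescale_add (hU.map_add s t hs ht) l, fun x => ?_⟩
  · simp [GibbsPerturbation.rescale, hU.map_zero]
  · have h1 : Tendsto (fun t : ℝ => Real.exp (-(l * t))) (𝓝[>] 0) (𝓝 1) := by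
      have : Continuous fun t : ℝ => Real.exp (-(l * t)) := by fun_prop
      simpa using (this.tendsto 0).mono_left nhdsWithin_le_nhds
    simpa using! h1.smul (hU.tendsto_zero x)

theorem hasGenValue_orbit (hU : IsC0Semigroup U) {x y : H} (h : HasGenValue U x y) {s : ℝ}
    (hs : 0 ≤ s) : HasGenValue U (U s x) (U s y) :=
  h.map (U s) fun _ ht => hU.commute hs (le_of_lt ht)

theorem tendsto_Ici (hU : IsC0Semigroup U) (x : H) :
    Tendsto (fun t => U t x) (𝓝[≥] 0) (𝓝 x) := by
  rw [← Set.Ioi_insert, nhdsWithin_insert]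
  refine tendsto_sup.2 ⟨?_, hU.tendsto_zero x⟩
  rw [tendsto_pure_left]
  intro s hs
  simpa [hU.map_zero] using mem_of_mem_nhds hs

variable [CompleteSpace H]

theorem exists_norm_le_near_zero (hU : IsC0Semigroup U) :
    ∃ δ > 0, ∃ M : ℝ, ∀ t, 0 ≤ t → t ≤ δ → ‖U t‖ ≤ M := by
  by_contra! hcon
  have hseq : ∀ n : ℕ, ∃ t : ℝ, 0 ≤ t ∧ t ≤ 1 / ((n : ℝ) + 1) ∧ (n : ℝ) < ‖U t‖ := fun n =>
    hcon _ (by positivity) n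
  choose t ht0 ht1 ht using hseq
  have hlim : Tendsto t atTop (𝓝[≥] 0) := by
    refine tendsto_nhdsWithin_iff.2 ⟨?_, Eventually.of_forall ht0⟩
    exact squeeze_zero ht0 ht1 tendsto_one_div_add_atTop_nhds_zero_nat
  obtain ⟨C, hC⟩ := banach_steinhaus (g := fun n => U (t n)) fun x => by
    obtain ⟨C, hC⟩ := (Metric.isBounded_range_of_tendsto _
      ((hU.tendsto_Ici x).comp hlim)).exists_norm_le
    exact ⟨C, fun n => hC _ ⟨n, rfl⟩⟩
  obtain ⟨n, hn⟩ := exists_nat_gt C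
  exact absurd (hC n) (not_le.2 (hn.trans (ht n)))

theorem exists_growth_bound (hU : IsC0Semigroup U) :
    ∃ M ω : ℝ, 1 ≤ M ∧ 0 ≤ ω ∧ ∀ t, 0 ≤ t → ‖U t‖ ≤ M * Real.exp (ω * t) := by
  obtain ⟨δ, hδ, M₀, hM₀⟩ := hU.exists_norm_le_near_zero
  set M := max M₀ 1 with hM
  have hM1 : 1 ≤ M := le_max_right _ _
  have hMpos : 0 < M := by linarith
  have hstep : ∀ n : ℕ, ∀ t, 0 ≤ t → t ≤ (n + 1) * δ → ‖U t‖ ≤ M ^ (n + 1) := by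
    intro n
    induction n with
    | zero =>
      intro t h0 h1
      rw [zero_add, pow_one]
      exact (hM₀ t h0 (by simpa using h1)).trans (le_max_left _ _)
    | succ n ih =>
      intro t h0 h1
      rcases le_total t δ with h | h
      · exact ((hM₀ t h0 h).trans (le_max_left _ _)).trans (le_self_pow₀ hM1 (by omega))
      · have h2 : ‖U (t - δ)‖ ≤ M ^ (n + 1) := by
          refine ih _ (by linarith) ?_
          push_cast at h1
          linarith
        have h3 : ‖U δ‖ ≤ M := (hM₀ δ hδ.le le_rfl).trans (le_max_left _ _)
        rw [show t = (t - δ) + δ by ring, hU.map_add_mul (by linarith) hδ.le, pow_succ]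
        exact (norm_mul_le _ _).trans (mul_le_mul h2 h3 (norm_nonneg _) (by positivity))
  refine ⟨M, Real.log M / δ, hM1, div_nonneg (Real.log_nonneg hM1) hδ.le, fun t ht => ?_⟩
  have h1 := hstep ⌊t / δ⌋₊ t ht (by
    have := (Nat.lt_floor_add_one (t / δ)).le
    rwa [div_le_iff₀ hδ] at this)
  refine h1.trans ?_
  rw [pow_succ, mul_comm]
  refine mul_le_mul_of_nonneg_left ?_ hMpos.le
  rw [← Real.rpow_natCast, Real.rpow_def_of_pos hMpos]
  refine Real.exp_le_exp.2 ?_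
  rw [div_mul_eq_mul_div, mul_div_assoc]
  exact mul_le_mul_of_nonneg_left (Nat.floor_le (by positivity)) (Real.log_nonneg hM1)

theorem exists_norm_le (hU : IsC0Semigroup U) (a : ℝ) :
    ∃ C : ℝ, 0 ≤ C ∧ ∀ t, 0 ≤ t → t ≤ a → ‖U t‖ ≤ C := by
  obtain ⟨M, ω, hM, hω, h⟩ := hU.exists_growth_bound
  refine ⟨M * Real.exp (ω * a), by positivity, fun t h0 h1 => (h t h0).trans ?_⟩
  gcongr

theorem continuousOn_orbit (hU : IsC0Semigroup U) (x : H) :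
    ContinuousOn (fun t => U t x) (Set.Ici 0) := by
  intro t ht
  have ht : 0 ≤ t := ht
  obtain ⟨C, hC0, hC⟩ := hU.exists_norm_le (t + 1)
  have hle : ∀ r s, 0 ≤ r → r ≤ s → r ≤ t + 1 → ‖U s x - U r x‖ ≤ C * ‖U (s - r) x - x‖ := by
    intro r s hr hrs hrt
    have : U s x = U r (U (s - r) x) := by
      rw [← ContinuousLinearMap.comp_apply, ← hU.map_add r (s - r) hr (by linarith)]
      congr 2
      ring
    rw [this, ← map_sub]
    exact (U r).le_of_opNorm_le (hC r hr hrt) _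
  have hlim : Tendsto (fun s => C * ‖U |s - t| x - x‖) (𝓝[Set.Ici 0] t) (𝓝 0) := by
    have h0 : Tendsto (fun s : ℝ => |s - t|) (𝓝 t) (𝓝[≥] 0) := by
      refine tendsto_nhdsWithin_iff.2 ⟨?_, Eventually.of_forall fun s => abs_nonneg (s - t)⟩
      have : Continuous fun s : ℝ => |s - t| := by fun_prop
      simpa using this.tendsto t
    have h1 := ((((hU.tendsto_Ici x).comp h0).sub_const x).norm).const_mul C
    simp only [sub_self, norm_zero, mul_zero] at h1
    exact h1.mono_left nhdsWithin_le_nhds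
  rw [ContinuousWithinAt, tendsto_iff_norm_sub_tendsto_zero]
  refine squeeze_zero' (Eventually.of_forall fun _ => norm_nonneg _) ?_ hlim
  have hm : Set.Iio (t + 1) ∈ 𝓝[Set.Ici 0] t :=
    nhdsWithin_le_nhds (Iio_mem_nhds (by linarith))
  filter_upwards [hm, self_mem_nhdsWithin] with s hs1 hs0
  rcases le_total t s with h | h
  · rw [abs_of_nonneg (by linarith)]
    exact hle t s ht h (by linarith)
  · rw [abs_of_nonpos (by linarith), norm_sub_rev, neg_sub]
    exact hle s t hs0 h (le_of_lt hs1)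

theorem tendsto_apply (hU : IsC0Semigroup U) {ι : Type*} {L : Filter ι} {g : ι → ℝ} {f : ι → H}
    {a : ℝ} {y : H} (hg : Tendsto g L (𝓝 a)) (hg0 : ∀ᶠ i in L, 0 ≤ g i) (ha : 0 ≤ a)
    (hf : Tendsto f L (𝓝 y)) : Tendsto (fun i => U (g i) (f i)) L (𝓝 (U a y)) := by
  obtain ⟨C, hC0, hC⟩ := hU.exists_norm_le (a + 1)
  have h1 : Tendsto (fun i => U (g i) y) L (𝓝 (U a y)) :=
    ((hU.continuousOn_orbit y) a ha).tendsto.comp (tendsto_nhdsWithin_iff.2 ⟨hg, hg0⟩)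
  have h2 : Tendsto (fun i => U (g i) (f i - y)) L (𝓝 0) := by
    have h3 : Tendsto (fun i => C * ‖f i - y‖) L (𝓝 0) := by
      simpa using (tendsto_iff_norm_sub_tendsto_zero.1 hf).const_mul C
    refine squeeze_zero_norm' ?_ h3
    filter_upwards [hg0, hg.eventually (Iio_mem_nhds (show a < a + 1 by linarith))] with i h0 h1
    exact (U (g i)).le_of_opNorm_le (hC _ h0 (le_of_lt h1)) _
  refine ((h2.add h1).congr fun i => ?_).trans (by rw [zero_add])
  rw [map_sub, sub_add_cancel]

/-- Two semigroups whose generators agree along the orbit of `x` under one of them have the same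
orbit of `x`: the function `s ↦ V(t - s) W(s) x` has right derivative zero. -/
theorem apply_eq_of_hasGenValue (hV : IsC0Semigroup V) (hW : IsC0Semigroup W) {x : H}
    (h : ∀ s, 0 ≤ s → ∃ y, HasGenValue V (W s x) y ∧ HasGenValue W (W s x) y) {t : ℝ}
    (ht : 0 ≤ t) : V t x = W t x := by
  set f : ℝ → H := fun s => V (t - s) (W s x) with hf
  have hcont : ContinuousOn f (Set.Icc 0 t) := by
    intro s hs
    refine hV.tendsto_apply (g := fun s => t - s) ?_ ?_ (sub_nonneg.2 hs.2) ?_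
    · exact ((continuous_const.sub continuous_id).tendsto s).mono_left nhdsWithin_le_nhds
    · filter_upwards [self_mem_nhdsWithin] with r hr using sub_nonneg.2 hr.2
    · exact ((hW.continuousOn_orbit x).mono Set.Icc_subset_Ici_self) s hs
  have hder : ∀ s ∈ Set.Ico 0 t, HasDerivWithinAt f 0 (Set.Ici s) s := by
    intro s hs
    rw [← hasDerivWithinAt_Ioi_iff_Ici, hasDerivWithinAt_iff_tendsto_slope'
      (Set.notMem_Ioi.2 le_rfl)]
    obtain ⟨y, hy, hy'⟩ := h s hs.1
    have hsh : Tendsto (fun r : ℝ => r - s) (𝓝[>] s) (𝓝[>] 0) := by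
      refine tendsto_nhdsWithin_iff.2 ⟨?_, ?_⟩
      · have : Continuous fun r : ℝ => r - s := by fun_prop
        simpa using (this.tendsto s).mono_left nhdsWithin_le_nhds
      · filter_upwards [self_mem_nhdsWithin] with r hr using sub_pos.2 (Set.mem_Ioi.1 hr)
    have hd := (Tendsto.sub hy hy').comp hsh
    rw [sub_self] at hd
    have hts : 0 < t - s := sub_pos.2 hs.2
    have hsub : Tendsto (fun r : ℝ => t - r) (𝓝[>] s) (𝓝 (t - s)) :=
      ((continuous_const.sub continuous_id).tendsto s).mono_left nhdsWithin_le_nhds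
    have hpos : ∀ᶠ r in 𝓝[>] s, 0 ≤ t - r := by
      filter_upwards [nhdsWithin_le_nhds (Iio_mem_nhds hs.2)] with r hr
      exact sub_nonneg.2 (le_of_lt hr)
    have := hV.tendsto_apply hsub hpos hts.le hd
    rw [_root_.map_zero] at this
    refine this.congr' ?_
    filter_upwards [hpos, self_mem_nhdsWithin] with r hr hrs
    have hrs : 0 < r - s := sub_pos.2 hrs
    have e1 : W r x = W (r - s) (W s x) := by
      rw [← ContinuousLinearMap.comp_apply, ← hW.map_add _ _ hrs.le hs.1, sub_add_cancel]
    have e2 : V (t - s) (W s x) = V (t - r) (V (r - s) (W s x)) := by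
      rw [← ContinuousLinearMap.comp_apply (V (t - r)), ← hV.map_add _ _ hr hrs.le,
        sub_add_sub_cancel]
    simp only [hf, slope_def_module, Function.comp_apply]
    rw [e1, e2, ← map_sub, ← (V (t - r)).map_smul_of_tower]
    congr 1
    module
  have := constant_of_has_deriv_right_zero hcont hder t ⟨ht, le_rfl⟩
  simpa only [hf, sub_self, sub_zero, hV.map_zero, hW.map_zero, ContinuousLinearMap.id_apply]
    using this.symm

/-- A `C₀`-semigroup is determined by its generator: if the generator of `V` extends that of `W`, and
the latter is densely defined, then `V = W`. -/
theorem eq_of_hasGenValue_imp (hV : IsC0Semigroup V) (hW : IsC0Semigroup W)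
    (h : ∀ x y, HasGenValue W x y → HasGenValue V x y)
    (hd : Dense {x | ∃ y, HasGenValue W x y}) {t : ℝ} (ht : 0 ≤ t) : V t = W t := by
  refine ContinuousLinearMap.coeFn_injective
    (Continuous.ext_on hd (V t).continuous (W t).continuous ?_)
  rintro x ⟨y, hy⟩
  refine hV.apply_eq_of_hasGenValue hW (fun s hs => ⟨W s y, ?_, ?_⟩) ht
  · exact h _ _ (hW.hasGenValue_orbit hy hs)
  · exact hW.hasGenValue_orbit hy hs

theorem eq_zero_of_hasGenValue_zero (hW : IsC0Semigroup W) {x : H} (hx : HasGenValue W x 0)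
    (hlim : Tendsto (fun t => ‖W t‖) atTop (𝓝 0)) : x = 0 := by
  have h1 : ∀ t, 0 ≤ t → x = W t x := fun t ht =>
    isC0Semigroup_id.apply_eq_of_hasGenValue hW (fun s hs => ⟨0, hasGenValue_id _, by
      simpa using hW.hasGenValue_orbit hx hs⟩) ht
  have h2 : Tendsto (fun t => ‖W t‖ * ‖x‖) atTop (𝓝 0) := by simpa using hlim.mul_const ‖x‖
  refine norm_le_zero_iff.1 (ge_of_tendsto h2 ?_)
  filter_upwards [eventually_ge_atTop 0] with t ht
  calc ‖x‖ = ‖W t x‖ := by rw [← h1 t ht]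
    _ ≤ _ := (W t).le_opNorm x

end IsC0Semigroup

end Semigroup

/-! ### Norm continuity and the Laplace transform -/

section Laplace

variable {H : Type*} [NormedAddCommGroup H] [InnerProductSpace ℂ H] [CompleteSpace H]

/-- A bounded family tending strongly to `S` tends in norm to `S K` after composition with a compact
operator `K`, because it converges uniformly on the relatively compact image of the unit ball. -/
theorem tendsto_mul_of_isCompactOperator {ι : Type*} {L : Filter ι} {D : ι → H →L[ℂ] H}
    {S K : H →L[ℂ] H} (hK : IsCompactOperator K) {C : ℝ} (hC : ∀ᶠ i in L, ‖D i‖ ≤ C)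
    (hD : ∀ x, Tendsto (fun i => D i x) L (𝓝 (S x))) :
    Tendsto (fun i => D i * K) L (𝓝 (S * K)) := by
  rw [Metric.tendsto_nhds]
  intro ε hε
  obtain ⟨Q, hQ, hKQ⟩ := hK.image_closedBall_subset_compact (f := (K : H →ₗ[ℂ] H)) 1
  set C' := |C| + ‖S‖ + 1 with hC'
  have hC'0 : 0 < C' := by positivity
  obtain ⟨F, hF, hQF⟩ := Metric.totallyBounded_iff.1 hQ.totallyBounded (ε / (4 * C'))
    (by positivity)
  have hFev : ∀ᶠ i in L, ∀ y ∈ F, ‖D i y - S y‖ < ε / 4 := by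
    rw [eventually_all_finite hF]
    intro y _
    have := (tendsto_iff_norm_sub_tendsto_zero.1 (hD y)).eventually
      (Iio_mem_nhds (show 0 < ε / 4 by positivity))
    exact this
  filter_upwards [hC, hFev] with i hi hFi
  have hDS : ‖D i - S‖ ≤ C' := by
    have := norm_sub_le (D i) S
    have := le_abs_self C
    linarith
  rw [dist_eq_norm, ← sub_mul]
  refine lt_of_le_of_lt (ContinuousLinearMap.opNorm_le_of_unit_norm (C := ε / 2) (by positivity)
    fun x hx => ?_) (by linarith)
  have hKx : K x ∈ Q := hKQ ⟨x, by simp [hx], rfl⟩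
  obtain ⟨y, hyF, hy⟩ := Set.mem_iUnion₂.1 (hQF hKx)
  rw [Metric.mem_ball, dist_eq_norm] at hy
  have h1 : (D i - S) (K x) = (D i - S) (K x - y) + (D i y - S y) := by
    simp only [map_sub, sub_apply]
    abel
  calc ‖((D i - S) * K) x‖ = ‖(D i - S) (K x)‖ := rfl
    _ ≤ ‖(D i - S) (K x - y)‖ + ‖D i y - S y‖ := by rw [h1]; exact norm_add_le _ _
    _ ≤ C' * (ε / (4 * C')) + ε / 4 := by
        refine add_le_add ?_ (hFi y hyF).le
        exact ((D i - S).le_of_opNorm_le hDS _).trans (mul_le_mul_of_nonneg_left hy.le hC'0.le)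
    _ = ε / 2 := by field_simp; ring

variable {U W : ℝ → H →L[ℂ] H}

theorem IsC0Semigroup.continuousOn_Ioi (hU : IsC0Semigroup U)
    (hK : ∀ t, 0 < t → IsCompactOperator (U t)) : ContinuousOn U (Set.Ioi 0) := by
  intro t ht
  have ht : 0 < t := ht
  refine ContinuousAt.continuousWithinAt ?_
  obtain ⟨C, -, hC⟩ := hU.exists_norm_le (t + 1)
  have hm : ∀ᶠ s in 𝓝 t, t / 2 < s ∧ s < t + 1 :=
    Ioo_mem_nhds (by linarith) (by linarith)
  have h1 : Tendsto (fun s => U (s - t / 2) * U (t / 2)) (𝓝 t) (𝓝 (U (t - t / 2) * U (t / 2))) := by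
    refine tendsto_mul_of_isCompactOperator (hK _ (by linarith)) (C := C) ?_ fun x => ?_
    · filter_upwards [hm] with s hs
      exact hC _ (by linarith [hs.1]) (by linarith [hs.2])
    · refine hU.tendsto_apply ?_ ?_ (by linarith) tendsto_const_nhds
      · exact (continuous_id.sub continuous_const).tendsto t
      · filter_upwards [hm] with s hs
        linarith [hs.1]
  have h2 : U (t - t / 2) * U (t / 2) = U t := by
    rw [← hU.map_add_mul (by linarith) (by linarith), sub_add_cancel]
  rw [h2] at h1
  refine h1.congr' ?_
  filter_upwards [hm] with s hs
  rw [← hU.map_add_mul (by linarith [hs.1]) (by linarith), sub_add_cancel]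

/-- For an integrable semigroup `W` with generator `G`, the operator `∫₀^∞ W(t) dt` is a right
inverse of `G`. -/
theorem IsC0Semigroup.hasGenValue_integral (hW : IsC0Semigroup W)
    (hWi : IntegrableOn W (Set.Ioi 0)) (x : H) :
    HasGenValue W ((∫ t in Set.Ioi 0, W t) x) x := by
  have hWx : IntegrableOn (fun s => W s x) (Set.Ioi 0) := hWi.apply_continuousLinearMap x
  have h1 : ∀ t, 0 < t → (∫ s in Set.Ioi 0, W s) x - W t ((∫ s in Set.Ioi 0, W s) x) =
      ∫ s in Set.Ioo 0 t, W s x := by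
    intro t ht
    have e1 : W t ((∫ s in Set.Ioi 0, W s) x) = ∫ s in Set.Ioi t, W s x := by
      rw [ContinuousLinearMap.integral_apply hWi, ← ContinuousLinearMap.integral_comp_comm _ hWx]
      have hpre : (fun r => r + t) ⁻¹' Set.Ioi t = Set.Ioi 0 := by ext r; simp
      symm
      rw [← (measurePreserving_add_right volume t).setIntegral_preimage_emb
        (measurableEmbedding_addRight t), hpre]
      refine setIntegral_congr_fun measurableSet_Ioi fun r hr => ?_
      rw [← ContinuousLinearMap.comp_apply, ← hW.map_add _ _ ht.le (le_of_lt hr), add_comm t]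
    have e2 : (∫ s in Set.Ioi 0, W s) x =
        (∫ s in Set.Ioo 0 t, W s x) + ∫ s in Set.Ioi t, W s x := by
      rw [ContinuousLinearMap.integral_apply hWi, ← Set.Ioc_union_Ioi_eq_Ioi ht.le,
        setIntegral_union (Set.Ioc_disjoint_Ioi le_rfl) measurableSet_Ioi
          (hWx.mono_set Set.Ioc_subset_Ioi_self) (hWx.mono_set (Set.Ioi_subset_Ioi ht.le)),
        integral_Ioc_eq_integral_Ioo]
    rw [e1, e2, add_sub_cancel_right]
  have h2 : Tendsto (fun t : ℝ => t⁻¹ • ∫ s in Set.Ioo 0 t, W s x) (𝓝[>] 0) (𝓝 x) := by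
    refine tendsto_inv_smul_setIntegral (F := fun _ s => W s x)
      (Eventually.of_forall fun t => hWx.mono_set Set.Ioo_subset_Ioi_self) fun ε hε => ?_
    have := (hW.tendsto_zero x).eventually (Metric.closedBall_mem_nhds x hε)
    obtain ⟨δ, hδ, h⟩ := mem_nhdsGT_iff_exists_Ioo_subset.1 this
    filter_upwards [Ioo_mem_nhdsGT hδ] with t ht s hs
    have := h ⟨hs.1, hs.2.trans ht.2⟩
    simpa [dist_eq_norm] using this
  refine h2.congr' ?_
  filter_upwards [self_mem_nhdsWithin] with t ht
  rw [h1 t ht]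

theorem IsC0Semigroup.integral_mul_comm (hW : IsC0Semigroup W)
    (hWi : IntegrableOn W (Set.Ioi 0)) {t : ℝ} (ht : 0 ≤ t) :
    (∫ s in Set.Ioi 0, W s) * W t = W t * ∫ s in Set.Ioi 0, W s := by
  rw [← integral_const_mul_of_integrable hWi, ← integral_mul_const_of_integrable hWi]
  exact setIntegral_congr_fun measurableSet_Ioi fun s hs => hW.commute (le_of_lt hs) ht

theorem IsC0Semigroup.dense_of_integrable (hW : IsC0Semigroup W)
    (hWi : IntegrableOn W (Set.Ioi 0)) : Dense {x | ∃ y, HasGenValue W x y} := by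
  intro x
  refine mem_closure_of_tendsto (hW.hasGenValue_integral hWi x) ?_
  filter_upwards [self_mem_nhdsWithin] with t ht
  have h := hW.hasGenValue_integral hWi x
  have h' := h.sub (hW.hasGenValue_orbit h (le_of_lt ht))
  refine ⟨t⁻¹ • (x - W t x), ?_⟩
  refine (h'.const_smul (t⁻¹ : ℝ)).congr fun s => ?_
  rw [(W s).map_smul_of_tower]
  module

/-- The Laplace transform `∫₀^∞ e^{-l t} U(t) dt` of a semigroup. -/
noncomputable def laplace (U : ℝ → H →L[ℂ] H) (l : ℝ) : H →L[ℂ] H :=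
  ∫ t in Set.Ioi 0, rescale l U t

/-- A family that is norm continuous on `(0, ∞)` and of exponential growth `M e^{ω t}`. -/
structure HasGrowth (U : ℝ → H →L[ℂ] H) (M ω : ℝ) : Prop where
  continuousOn : ContinuousOn U (Set.Ioi 0)
  norm_le : ∀ t, 0 < t → ‖U t‖ ≤ M * Real.exp (ω * t)

namespace HasGrowth

variable {M ω l : ℝ}

theorem nonneg (h : HasGrowth U M ω) : 0 ≤ M :=
  nonneg_of_mul_nonneg_left ((norm_nonneg _).trans (h.norm_le 1 one_pos)) (Real.exp_pos _)

theorem norm_rescale_le (h : HasGrowth U M ω) (l : ℝ) {t : ℝ} (ht : 0 < t) :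
    ‖rescale l U t‖ ≤ M * Real.exp (-(l - ω) * t) := by
  rw [norm_rescale]
  calc Real.exp (-(l * t)) * ‖U t‖ ≤ Real.exp (-(l * t)) * (M * Real.exp (ω * t)) :=
        mul_le_mul_of_nonneg_left (h.norm_le t ht) (Real.exp_pos _).le
    _ = M * (Real.exp (-(l * t)) * Real.exp (ω * t)) := by ring
    _ = _ := by rw [← Real.exp_add]; ring_nf

theorem integrableOn (h : HasGrowth U M ω) (hl : ω < l) :
    IntegrableOn (rescale l U) (Set.Ioi 0) := by
  refine Integrable.mono' ((integrableOn_exp_mul_Ioi (a := -(l - ω)) (by linarith) 0).const_mul M)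
    ((continuousOn_rescale h.continuousOn l).aestronglyMeasurable measurableSet_Ioi) ?_
  exact (ae_restrict_iff' measurableSet_Ioi).2 (ae_of_all _ fun t ht => h.norm_rescale_le l ht)

theorem norm_laplace_le (h : HasGrowth U M ω) (hl : ω < l) : ‖laplace U l‖ ≤ M / (l - ω) := by
  have h1 := integral_exp_mul_Ioi (a := -(l - ω)) (by linarith) 0
  have h2 : ‖laplace U l‖ ≤ ∫ t in Set.Ioi 0, M * Real.exp (-(l - ω) * t) :=
    norm_integral_le_of_norm_le ((integrableOn_exp_mul_Ioi (by linarith) 0).const_mul M)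
      ((ae_restrict_iff' measurableSet_Ioi).2 (ae_of_all _ fun t ht => h.norm_rescale_le l ht))
  refine h2.trans (le_of_eq ?_)
  rw [integral_const_mul, h1]
  rw [mul_zero, Real.exp_zero, neg_div_neg_eq, mul_one_div]

theorem tendsto_norm_rescale (h : HasGrowth U M ω) (hl : ω < l) :
    Tendsto (fun t => ‖rescale l U t‖) atTop (𝓝 0) := by
  have h1 : Tendsto (fun t : ℝ => M * Real.exp (-(l - ω) * t)) atTop (𝓝 (M * 0)) := by
    refine (Real.tendsto_exp_atBot.comp ?_).const_mul M
    exact tendsto_id.const_mul_atTop_of_neg (by linarith)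
  rw [mul_zero] at h1
  refine squeeze_zero' (Eventually.of_forall fun _ => norm_nonneg _) ?_ h1
  filter_upwards [eventually_gt_atTop 0] with t ht using h.norm_rescale_le l ht

theorem hasGenValue_laplace (h : HasGrowth U M ω) (hU : IsC0Semigroup U) (hl : ω < l) (x : H) :
    HasGenValue U (laplace U l x) (x - l • laplace U l x) := by
  rw [← hasGenValue_rescale_iff (l := l), sub_add_cancel]
  exact (hU.rescale l).hasGenValue_integral (h.integrableOn hl) x

theorem eq_of_hasGenValue (h : HasGrowth U M ω) (hU : IsC0Semigroup U) (hl : ω < l) {u v y z : H}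
    (hu : HasGenValue U u y) (hv : HasGenValue U v z) (heq : y + l • u = z + l • v) : u = v := by
  have h1 := (hu.rescale l).sub (hv.rescale l)
  rw [heq, sub_self] at h1
  exact sub_eq_zero.1
    ((hU.rescale l).eq_zero_of_hasGenValue_zero h1 (h.tendsto_norm_rescale hl))

theorem laplace_apply (h : HasGrowth U M ω) (hU : IsC0Semigroup U) (hl : ω < l) {u y : H}
    (hu : HasGenValue U u y) : laplace U l (y + l • u) = u :=
  h.eq_of_hasGenValue hU hl (h.hasGenValue_laplace hU hl _) hu (by abel)

theorem laplace_mul_comm (h : HasGrowth U M ω) (hU : IsC0Semigroup U) (hl : ω < l) {t : ℝ}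
    (ht : 0 ≤ t) : laplace U l * U t = U t * laplace U l := by
  have h1 := (hU.rescale l).integral_mul_comm (h.integrableOn hl) ht
  have h2 : rescale (-l) (rescale l U) t = U t := by rw [rescale_neg_rescale]
  rw [← h2, rescale, mul_smul_comm, smul_mul_assoc]
  congr 1

theorem dense (h : HasGrowth U M ω) (hU : IsC0Semigroup U) :
    Dense {x | ∃ y, HasGenValue U x y} := by
  refine ((hU.rescale (ω + 1)).dense_of_integrable (h.integrableOn (by linarith))).mono ?_
  rintro x ⟨y, hy⟩
  refine ⟨y - (ω + 1) • x, ?_⟩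
  rwa [← hasGenValue_rescale_iff (l := ω + 1), sub_add_cancel]

theorem tendsto_laplace_apply (h : HasGrowth U M ω) (x : H) :
    Tendsto (fun l => laplace U l x) atTop (𝓝 0) := by
  have h1 : Tendsto (fun l => M / (l - ω) * ‖x‖) atTop (𝓝 0) := by
    have : Tendsto (fun l => M / (l - ω)) atTop (𝓝 0) :=
      (tendsto_atTop_add_const_right atTop (-ω) tendsto_id).const_div_atTop M
    simpa using this.mul_const ‖x‖
  refine squeeze_zero_norm' ?_ h1
  filter_upwards [eventually_gt_atTop ω] with l hl
  exact (laplace U l).le_of_opNorm_le (h.norm_laplace_le hl) x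

theorem tendsto_smul_laplace_apply (h : HasGrowth U M ω) (hU : IsC0Semigroup U) (x : H) :
    Tendsto (fun l => l • laplace U l x) atTop (𝓝 x) := by
  have hM := h.nonneg
  rw [Metric.tendsto_nhds]
  intro ε hε
  -- The norms of `l • laplace U l` are at most `2 * M` for large `l`.
  obtain ⟨u, ⟨y, hu⟩, hxu⟩ := Metric.mem_closure_iff.1 (h.dense hU x)
    (ε / (2 * (2 * M + 1))) (by positivity)
  rw [dist_eq_norm] at hxu
  have h1 := (h.tendsto_laplace_apply y).eventually
    (Metric.ball_mem_nhds 0 (show 0 < ε / 2 by positivity))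
  filter_upwards [h1, eventually_gt_atTop ω, eventually_gt_atTop 0,
    eventually_ge_atTop (2 * ω)] with l hl hlω hl0 hl2
  have hb : ‖l • laplace U l‖ ≤ 2 * M := by
    rw [norm_smul, Real.norm_eq_abs, abs_of_pos hl0]
    calc l * ‖laplace U l‖ ≤ l * (M / (l - ω)) :=
          mul_le_mul_of_nonneg_left (h.norm_laplace_le hlω) hl0.le
      _ ≤ 2 * M := by
          rw [mul_div_assoc', div_le_iff₀ (by linarith)]
          nlinarith
  have h2 : l • laplace U l x - x =
      (l • laplace U l) (x - u) - (x - u) - laplace U l y := by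
    have e := h.laplace_apply hU hlω hu
    rw [map_add, (laplace U l).map_smul_of_tower] at e
    rw [map_sub, smul_apply, smul_apply]
    rw [eq_sub_of_add_eq e]
    abel
  rw [dist_zero_right] at hl
  rw [dist_eq_norm, h2]
  calc _ ≤ ‖(l • laplace U l) (x - u)‖ + ‖x - u‖ + ‖laplace U l y‖ :=
        (norm_sub_le _ _).trans (add_le_add_left (norm_sub_le _ _) _)
    _ ≤ 2 * M * ‖x - u‖ + ‖x - u‖ + ‖laplace U l y‖ := by
        gcongr
        exact (l • laplace U l).le_of_opNorm_le hb _
    _ < ε / 2 + ε / 2 := by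
        refine add_lt_add_of_le_of_lt ?_ hl
        calc 2 * M * ‖x - u‖ + ‖x - u‖ = (2 * M + 1) * ‖x - u‖ := by ring
          _ ≤ (2 * M + 1) * (ε / (2 * (2 * M + 1))) := by gcongr
          _ = ε / 2 := by field_simp
    _ = ε := by ring

end HasGrowth

theorem IsC0Semigroup.exists_hasGrowth (hU : IsC0Semigroup U)
    (hK : ∀ t, 0 < t → IsCompactOperator (U t)) : ∃ M ω : ℝ, HasGrowth U M ω := by
  obtain ⟨M, ω, -, -, h⟩ := hU.exists_growth_bound
  exact ⟨M, ω, hU.continuousOn_Ioi hK, fun t ht => h t ht.le⟩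

/-! ### The resolvent and the extension of the perturbation -/

theorem IsResolventAt.eq {A : H →ₗ.[ℂ] H} {z : ℂ} {R R' : H →L[ℂ] H} (hR : IsResolventAt A z R)
    (hR' : IsResolventAt A z R') : R = R' := by
  ext x
  obtain ⟨u, hu, hAu⟩ := (LinearPMap.mem_graph_iff A).1 (hR.1 x)
  simp only at hu hAu
  have := hR'.2 u
  rw [hAu, hu, add_sub_cancel_right] at this
  exact this.symm

theorem resolvent_eq {A : H →ₗ.[ℂ] H} {z : ℂ} {R : H →L[ℂ] H} (hR : IsResolventAt A z R) :
    resolvent A z = R := by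
  have h : ∃ R : H →L[ℂ] H, IsResolventAt A z R := ⟨R, hR⟩
  rw [resolvent, dif_pos h]
  exact h.choose_spec.eq hR

variable {A B : H →ₗ.[ℂ] H} {M ω l : ℝ}

theorem HasGrowth.isResolventAt (h : HasGrowth U M ω) (hU : IsC0Semigroup U) (hA : IsGenerator A U)
    (hl : ω < l) : IsResolventAt A ((-l : ℝ) : ℂ) (laplace U l) := by
  refine ⟨fun x => ?_, fun u => ?_⟩
  · rw [hA.mem_graph_iff, Complex.coe_smul, neg_smul, ← sub_eq_add_neg]
    exact h.hasGenValue_laplace hU hl x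
  · have hu : HasGenValue U u (A u) := hA.mem_graph_iff.1 (A.mem_graph u)
    rw [Complex.coe_smul, neg_smul, sub_neg_eq_add]
    exact h.laplace_apply hU hl hu

/-- `B` is bounded relative to `A`, with constants `a`, `b`. -/
def RelBounded (A B : H →ₗ.[ℂ] H) (a b : ℝ) : Prop :=
  ∀ u v w : H, (u, v) ∈ A.graph → (u, w) ∈ B.graph → ‖w‖ ≤ a * ‖u‖ + b * ‖v‖

theorem mem_graph_compResolvent (hdom : B.domain = A.domain) {z : ℂ} {R : H →L[ℂ] H}
    (hR : IsResolventAt A z R) (x : H) : (R x, compResolvent A B z x) ∈ B.graph := by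
  have hx : ∀ x, resolvent A z x ∈ B.domain := fun x => by
    rw [resolvent_eq hR, hdom]
    exact LinearPMap.mem_domain_of_mem_graph (hR.1 x)
  rw [compResolvent, dif_pos hx, ← resolvent_eq hR]
  exact B.mem_graph ⟨resolvent A z x, hx x⟩

/-- The extension `ext A B` agrees with `B` on the domain of `A`. -/
theorem HasGrowth.mem_graph_ext (h : HasGrowth U M ω) (hU : IsC0Semigroup U)
    (hA : IsGenerator A U) (hdom : B.domain = A.domain) {a b : ℝ} (hrel : RelBounded A B a b)
    {x w : H} (hw : (x, w) ∈ B.graph) : (x, w) ∈ (ext A B).graph := by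
  rw [mem_graph_ext_iff, IsExtValue]
  have hx : x ∈ A.domain := hdom ▸ LinearPMap.mem_domain_of_mem_graph hw
  obtain ⟨y, hy⟩ := LinearPMap.mem_domain_iff.1 hx
  have hy' := hA.mem_graph_iff.1 hy
  suffices hs : Tendsto (fun l : ℝ => l • compResolvent A B ((-l : ℝ) : ℂ) x) atTop (𝓝 w) by
    refine (hs.comp tendsto_neg_atBot_atTop).congr' ?_
    filter_upwards [eventually_le_atBot 0] with l hl
    simp only [Function.comp_apply, neg_neg, abs_of_nonpos hl, Complex.coe_smul]
  have h0 : Tendsto (fun l => a * ‖laplace U l y‖ + b * ‖y - l • laplace U l y‖) atTop (𝓝 0) := by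
    have e1 := ((h.tendsto_laplace_apply y).norm).const_mul a
    have e2 := (((h.tendsto_smul_laplace_apply hU y).const_sub y).norm).const_mul b
    simpa using e1.add e2
  rw [tendsto_iff_norm_sub_tendsto_zero]
  refine squeeze_zero' (Eventually.of_forall fun _ => norm_nonneg _) ?_ h0
  filter_upwards [eventually_gt_atTop ω] with l hl
  have hR := h.isResolventAt hU hA hl
  have g1 := mem_graph_compResolvent hdom hR x
  -- `x - l • R x = R y`, on which the relative bound is applied.
  have e : x - l • laplace U l x = laplace U l y := by
    have e := h.laplace_apply hU hl hy'
    rw [map_add, (laplace U l).map_smul_of_tower] at e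
    nth_rewrite 1 [← e]
    abel
  have g2 : (x - l • laplace U l x, w - l • compResolvent A B ((-l : ℝ) : ℂ) x) ∈ B.graph := by
    have := B.graph.sub_mem hw (B.graph.smul_mem ((l : ℝ) : ℂ) g1)
    simpa [Complex.coe_smul] using this
  rw [e] at g2
  rw [norm_sub_rev]
  exact hrel _ _ _ (hA.mem_graph_iff.2 (h.hasGenValue_laplace hU hl y)) g2

end Laplace

/-! ### The perturbed semigroup -/

section Perturbation

variable {H : Type*} [NormedAddCommGroup H] [InnerProductSpace ℂ H] [CompleteSpace H]

theorem mem_graph_add_iff {A B : H →ₗ.[ℂ] H} {x z : H} : (x, z) ∈ (A + B).graph ↔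
    ∃ y w, (x, y) ∈ A.graph ∧ (x, w) ∈ B.graph ∧ z = y + w := by
  rw [LinearPMap.mem_graph_iff]
  constructor
  · rintro ⟨u, rfl, rfl⟩
    exact ⟨_, _, A.mem_graph ⟨u, u.2.1⟩, B.mem_graph ⟨u, u.2.2⟩, LinearPMap.add_apply A B u⟩
  · rintro ⟨y, w, hy, hw, rfl⟩
    obtain ⟨u, hu, rfl⟩ := (LinearPMap.mem_graph_iff A).1 hy
    obtain ⟨u', hu', rfl⟩ := (LinearPMap.mem_graph_iff B).1 hw
    simp only at hu hu'
    subst hu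
    refine ⟨⟨u, u.2, hu' ▸ u'.2⟩, rfl, ?_⟩
    rw [LinearPMap.add_apply]
    congr 2
    exact Subtype.ext hu'.symm

variable {A B : H →ₗ.[ℂ] H} {U T : ℝ → H →L[ℂ] H} {M ω a b l : ℝ}

/-- The data of the perturbation problem: `A` generates the semigroup `U`, which is norm continuous
on `(0, ∞)` and of growth `M e^{ω t}`, the operator `B` is bounded relative to `A` with constants
`a`, `b`, and `T t` is the bounded operator `B̃ U(t)`, of integrable norm near zero. -/
structure IsPerturbation (A B : H →ₗ.[ℂ] H) (U T : ℝ → H →L[ℂ] H) (M ω a b : ℝ) : Prop where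
  isC0Semigroup : IsC0Semigroup U
  hasGrowth : HasGrowth U M ω
  isGenerator : IsGenerator A U
  domain_eq : B.domain = A.domain
  relBounded : RelBounded A B a b
  mem_graph_ext : ∀ t : ℝ, 0 < t → ∀ x : H, (U t x, T t x) ∈ (ext A B).graph
  lintegral_lt_top : (∫⁻ s in Set.Ioo (0 : ℝ) 1, ‖T s‖ₑ) < ⊤

namespace IsPerturbation

theorem map_add (h : IsPerturbation A B U T M ω a b) {s t : ℝ} (hs : 0 < s) (ht : 0 ≤ t) :
    T (s + t) = T s * U t := by
  ext x
  refine LinearPMap.mem_graph_snd_inj' (f := ext A B) (h.mem_graph_ext _ (by linarith) x)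
    (h.mem_graph_ext s hs (U t x)) ?_
  simp only
  rw [h.isC0Semigroup.map_add s t hs.le ht]
  rfl

theorem apply_eq (h : IsPerturbation A B U T M ω a b) {t : ℝ} (ht : 0 < t) {x w : H}
    (hw : (U t x, w) ∈ B.graph) : T t x = w :=
  LinearPMap.mem_graph_snd_inj' (f := ext A B) (h.mem_graph_ext t ht x)
    (h.hasGrowth.mem_graph_ext h.isC0Semigroup h.isGenerator h.domain_eq h.relBounded hw) rfl

theorem continuousOn (h : IsPerturbation A B U T M ω a b) : ContinuousOn T (Set.Ioi 0) := by
  intro t ht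
  have ht : 0 < t := ht
  refine ContinuousAt.continuousWithinAt ?_
  have h1 : ContinuousAt (fun s => T (t / 2) * U (s - t / 2)) t := by
    refine continuousAt_const.mul (ContinuousAt.comp (g := U) (f := fun s => s - t / 2) ?_ ?_)
    · exact h.hasGrowth.continuousOn.continuousAt (Ioi_mem_nhds (by linarith))
    · fun_prop
  refine h1.congr ?_
  filter_upwards [Ioi_mem_nhds (show t / 2 < t by linarith)] with s hs
  rw [← h.map_add (by linarith) (sub_nonneg.2 (le_of_lt hs)), add_sub_cancel]

theorem integrableOn (h : IsPerturbation A B U T M ω a b) (hl : ω < l) :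
    IntegrableOn (rescale l T) (Set.Ioi 0) := by
  have hcont := continuousOn_rescale h.continuousOn l
  rw [← Set.Ioo_union_Ici_eq_Ioi one_pos]
  refine IntegrableOn.union ?_ ?_
  · have hT : IntegrableOn T (Set.Ioo 0 1) :=
      ⟨(h.continuousOn.mono Set.Ioo_subset_Ioi_self).aestronglyMeasurable measurableSet_Ioo,
        h.lintegral_lt_top⟩
    refine Integrable.mono' (hT.norm.const_mul (Real.exp |l|))
      ((hcont.mono Set.Ioo_subset_Ioi_self).aestronglyMeasurable measurableSet_Ioo) ?_
    refine (ae_restrict_iff' measurableSet_Ioo).2 (ae_of_all _ fun t ht => ?_)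
    rw [norm_rescale]
    refine mul_le_mul_of_nonneg_right (Real.exp_le_exp.2 ?_) (norm_nonneg _)
    calc -(l * t) ≤ |l * t| := neg_le_abs _
      _ = |l| * t := by rw [abs_mul, abs_of_pos ht.1]
      _ ≤ |l| := mul_le_of_le_one_right (abs_nonneg _) ht.2.le
  · have hsub : Set.Ici (1 : ℝ) ⊆ Set.Ioi 0 := Set.Ici_subset_Ioi.2 one_pos
    set C := ‖T (1 / 2)‖ * (M * Real.exp (-(ω / 2)))
    have hg : IntegrableOn (fun t => C * Real.exp (-(l - ω) * t)) (Set.Ici 1) :=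
      ((integrableOn_exp_mul_Ioi (by linarith) 0).mono_set hsub).const_mul C
    refine Integrable.mono' hg ((hcont.mono hsub).aestronglyMeasurable measurableSet_Ici) ?_
    refine (ae_restrict_iff' measurableSet_Ici).2 (ae_of_all _ fun t ht => ?_)
    have ht : 1 ≤ t := ht
    have h1 : T t = T (1 / 2) * U (t - 1 / 2) := by
      rw [← h.map_add (by norm_num) (by linarith), add_sub_cancel]
    have h2 := h.hasGrowth.norm_le (t - 1 / 2) (by linarith)
    rw [norm_rescale, h1]
    calc Real.exp (-(l * t)) * ‖T (1 / 2) * U (t - 1 / 2)‖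
        ≤ Real.exp (-(l * t)) * (‖T (1 / 2)‖ * (M * Real.exp (ω * (t - 1 / 2)))) := by
          gcongr
          exact (norm_mul_le _ _).trans (by gcongr)
      _ = ‖T (1 / 2)‖ * M * (Real.exp (-(l * t)) * Real.exp (ω * (t - 1 / 2))) := by ring
      _ = ‖T (1 / 2)‖ * M * (Real.exp (-(ω / 2)) * Real.exp (-(l - ω) * t)) := by
          rw [← Real.exp_add, ← Real.exp_add]
          ring_nf
      _ = C * Real.exp (-(l - ω) * t) := by ring

/-- The `L¹`-norm of `e^{-l t} T(t)` tends to zero as `l → ∞`. -/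
theorem tendsto_integral_norm_rescale (h : IsPerturbation A B U T M ω a b) :
    Tendsto (fun l => ∫ t in Set.Ioi 0, ‖rescale l T t‖) atTop (𝓝 0) := by
  suffices hs : Tendsto (fun l => ∫ t in Set.Ioi 0, ‖rescale l T t‖) atTop
      (𝓝 (∫ _ in Set.Ioi (0 : ℝ), (0 : ℝ))) by simpa using hs
  refine tendsto_integral_filter_of_dominated_convergence (fun t => ‖rescale (ω + 1) T t‖)
    (Eventually.of_forall fun l => ((continuousOn_rescale h.continuousOn l).aestronglyMeasurable
      measurableSet_Ioi).norm) ?_ (h.integrableOn (by linarith)).norm ?_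
  · filter_upwards [eventually_ge_atTop (ω + 1)] with l hl
    refine (ae_restrict_iff' measurableSet_Ioi).2 (ae_of_all _ fun t ht => ?_)
    have ht : 0 < t := ht
    rw [norm_norm, norm_rescale, norm_rescale]
    gcongr
  · refine (ae_restrict_iff' measurableSet_Ioi).2 (ae_of_all _ fun t ht => ?_)
    simp only [norm_rescale]
    have h1 : Tendsto (fun l : ℝ => Real.exp (-(l * t))) atTop (𝓝 0) :=
      Real.tendsto_exp_neg_atTop_nhds_zero.comp (tendsto_id.atTop_mul_const ht)
    simpa using h1.mul_const ‖T t‖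

/-- The operator `B (A + l)⁻¹` is the Laplace transform of `T`. -/
theorem mem_graph_laplace (h : IsPerturbation A B U T M ω a b) (hl : ω < l) (x : H) :
    (laplace U l x, laplace T l x) ∈ B.graph := by
  have hU := h.isC0Semigroup
  have hR := h.hasGrowth.isResolventAt hU h.isGenerator hl
  set R := laplace U l with hRdef
  have hB := mem_graph_compResolvent h.domain_eq hR
  have hAR : ∀ x, (R x, x - l • R x) ∈ A.graph := fun x =>
    h.isGenerator.mem_graph_iff.2 (h.hasGrowth.hasGenValue_laplace hU hl x)
  -- The relative bound makes `B (A + l)⁻¹` a bounded operator `C`.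
  let C : H →L[ℂ] H := (compResolvent A B ((-l : ℝ) : ℂ)).mkContinuous
    (|a| * ‖R‖ + |b| * (1 + ‖l • R‖)) fun x => by
      refine (h.relBounded _ _ _ (hAR x) (hB x)).trans ?_
      have h1 : ‖R x‖ ≤ ‖R‖ * ‖x‖ := R.le_opNorm x
      have h2 : ‖x - l • R x‖ ≤ (1 + ‖l • R‖) * ‖x‖ := by
        rw [add_mul, one_mul]
        exact (norm_sub_le _ _).trans (add_le_add_right ((l • R).le_opNorm x) _)
      calc a * ‖R x‖ + b * ‖x - l • R x‖ ≤ |a| * ‖R x‖ + |b| * ‖x - l • R x‖ := by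
            gcongr <;> exact le_abs_self _
        _ ≤ |a| * (‖R‖ * ‖x‖) + |b| * ((1 + ‖l • R‖) * ‖x‖) := by gcongr
        _ = _ := by ring
  have hC : ∀ x, (R x, C x) ∈ B.graph := hB
  suffices hCT : C = laplace T l by
    rw [← hCT]
    exact hC x
  -- Both operators agree on the range of `R`, since `T t R = B R U t`.
  have key : ∀ y, C (R y) = laplace T l (R y) := by
    intro y
    have h1 : R y = ∫ t in Set.Ioi 0, rescale l U t y :=
      ContinuousLinearMap.integral_apply (h.hasGrowth.integrableOn hl) y
    have h2 : laplace T l (R y) = ∫ t in Set.Ioi 0, rescale l T t (R y) :=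
      ContinuousLinearMap.integral_apply (h.integrableOn hl) (R y)
    rw [h2]
    nth_rewrite 1 [h1]
    rw [← ContinuousLinearMap.integral_comp_comm C
      ((h.hasGrowth.integrableOn hl).apply_continuousLinearMap y)]
    refine setIntegral_congr_fun measurableSet_Ioi fun t ht => ?_
    have ht : 0 < t := ht
    have h3 : U t (R y) = R (U t y) :=
      (DFunLike.congr_fun (h.hasGrowth.laplace_mul_comm hU hl ht.le) y).symm
    have h4 : T t (R y) = C (U t y) := h.apply_eq ht (by rw [h3]; exact hC _)
    simp only [rescale_apply, h4, C.map_smul_of_tower]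
  refine ContinuousLinearMap.coeFn_injective
    (Continuous.ext_on (h.hasGrowth.dense hU) C.continuous (laplace T l).continuous ?_)
  rintro x ⟨y, hy⟩
  rw [← h.hasGrowth.laplace_apply hU hl hy]
  exact key _

/-- On the domain, `T t x = B U(t) x` tends to `B x`. -/
theorem tendsto_apply (h : IsPerturbation A B U T M ω a b) {x y w : H} (hy : (x, y) ∈ A.graph)
    (hw : (x, w) ∈ B.graph) : Tendsto (fun t => T t x) (𝓝[>] 0) (𝓝 w) := by
  have hU := h.isC0Semigroup
  have h0 : Tendsto (fun t => a * ‖U t x - x‖ + b * ‖U t y - y‖) (𝓝[>] 0) (𝓝 0) := by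
    have e1 := (((hU.tendsto_zero x).sub_const x).norm).const_mul a
    have e2 := (((hU.tendsto_zero y).sub_const y).norm).const_mul b
    simpa using e1.add e2
  rw [tendsto_iff_norm_sub_tendsto_zero]
  refine squeeze_zero' (Eventually.of_forall fun _ => norm_nonneg _) ?_ h0
  filter_upwards [self_mem_nhdsWithin] with t ht
  have ht : 0 < t := ht
  have h1 : (U t x, U t y) ∈ A.graph := h.isGenerator.mem_graph_iff.2
    (hU.hasGenValue_orbit (h.isGenerator.mem_graph_iff.1 hy) ht.le)
  have h2 : U t x ∈ B.domain := h.domain_eq ▸ LinearPMap.mem_domain_of_mem_graph h1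
  obtain ⟨z, hz⟩ := LinearPMap.mem_domain_iff.1 h2
  rw [h.apply_eq ht hz]
  exact h.relBounded _ _ _ (A.graph.sub_mem h1 hy) (B.graph.sub_mem hz hw)

end IsPerturbation

/-- A `C₀`-semigroup from a solution of the Volterra equation, the value at `0` being the
identity. -/
theorem isC0Semigroup_of_eq_sub_volterra {u τ v : ℝ → H →L[ℂ] H} {C : ℝ} (hu : IsC0Semigroup u)
    (hτu : ∀ s t, 0 < s → 0 < t → τ (s + t) = τ s * u t)
    (hτ : IntegrableOn τ (Set.Ioi 0)) (hq : ∫ s in Set.Ioi 0, ‖τ s‖ < 1)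
    (hv : ContinuousOn v (Set.Ioi 0)) (hvC : ∀ t, 0 < t → ‖v t‖ ≤ C)
    (hvu : ∀ t, 0 < t → v t = u t - volterra v τ t) (hv0 : v 0 = 1) : IsC0Semigroup v := by
  refine ⟨hv0, fun s t hs ht => ?_, fun x => ?_⟩
  · rcases hs.eq_or_lt with rfl | hs
    · rw [zero_add, hv0]
      rfl
    rcases ht.eq_or_lt with rfl | ht
    · rw [add_zero, hv0]
      rfl
    exact mul_of_eq_sub_volterra (fun s t hs ht => hu.map_add_mul hs.le ht.le) hτu hτ hq hv hvC
      hvu s t hs ht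
  · have h1 : Tendsto (fun t => volterra v τ t x) (𝓝[>] 0) (𝓝 0) := by
      have hc : Continuous fun t => volterra v τ t x :=
        (continuous_volterra hv hvC hτ).clm_apply continuous_const
      have := hc.tendsto 0
      rw [show volterra v τ 0 = 0 by simp [volterra]] at this
      exact this.mono_left nhdsWithin_le_nhds
    have h2 := (hu.tendsto_zero x).sub h1
    rw [sub_zero] at h2
    refine h2.congr' ?_
    filter_upwards [self_mem_nhdsWithin] with t ht
    rw [hvu t ht]
    rfl

/-- The generator of the solution of the Volterra equation, at a vector along which `τ` has a
limit at zero. -/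
theorem hasGenValue_of_eq_sub_volterra {u τ v : ℝ → H →L[ℂ] H} {C : ℝ}
    (hτ : IntegrableOn τ (Set.Ioi 0)) (hv : IsC0Semigroup v)
    (hvc : ContinuousOn v (Set.Ioi 0)) (hvC : ∀ t, 0 < t → ‖v t‖ ≤ C)
    (hvu : ∀ t, 0 < t → v t = u t - volterra v τ t) {x y w : H} (hx : HasGenValue u x y)
    (hw : Tendsto (fun t => τ t x) (𝓝[>] 0) (𝓝 w)) : HasGenValue v x (y + w) := by
  have hC : 0 ≤ C := (norm_nonneg _).trans (hvC 1 one_pos)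
  have hI := integrableOn_volterra hvc hvC hτ
  have h1 : Tendsto (fun t : ℝ => t⁻¹ • ∫ s in Set.Ioo 0 t, v (t - s) (τ s x)) (𝓝[>] 0) (𝓝 w) := by
    refine tendsto_inv_smul_setIntegral (F := fun t s => v (t - s) (τ s x))
      (Eventually.of_forall fun t => (hI t).apply_continuousLinearMap x) fun ε hε => ?_
    have e1 := hw.eventually (Metric.closedBall_mem_nhds w
      (show 0 < ε / (2 * (C + 1)) by positivity))
    have e2 := (hv.tendsto_zero w).eventually (Metric.closedBall_mem_nhds w
      (show 0 < ε / 2 by positivity))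
    obtain ⟨δ, hδ, h⟩ := mem_nhdsGT_iff_exists_Ioo_subset.1 (e1.and e2)
    filter_upwards [Ioo_mem_nhdsGT hδ] with t ht s hs
    have b1 := (h ⟨hs.1, hs.2.trans ht.2⟩).1
    have b2 := (h (show t - s ∈ Set.Ioo 0 δ from
      ⟨sub_pos.2 hs.2, by linarith [hs.1, ht.2]⟩)).2
    rw [dist_eq_norm] at b1 b2
    have e : v (t - s) (τ s x) - w = v (t - s) (τ s x - w) + (v (t - s) w - w) := by
      rw [map_sub]
      abel
    calc ‖v (t - s) (τ s x) - w‖ ≤ ‖v (t - s) (τ s x - w)‖ + ‖v (t - s) w - w‖ := by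
          rw [e]
          exact norm_add_le _ _
      _ ≤ (C + 1) * (ε / (2 * (C + 1))) + ε / 2 := by
          refine add_le_add ?_ b2
          refine ((v (t - s)).le_of_opNorm_le (hvC _ (sub_pos.2 hs.2)) _).trans ?_
          gcongr
          linarith
      _ = ε := by field_simp; ring
  refine (Tendsto.add hx h1).congr' ?_
  filter_upwards [self_mem_nhdsWithin] with t ht
  have e : volterra v τ t x = ∫ s in Set.Ioo 0 t, v (t - s) (τ s x) :=
    ContinuousLinearMap.integral_apply (hI t) x
  rw [← e, hvu t ht, sub_apply]
  module

/-- The perturbation theorem: `A + B` generates a `C₀`-semigroup `V`, which solves the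
Volterra equation `V = U - V ∗ T`. -/
theorem IsPerturbation.exists_semigroup (h : IsPerturbation A B U T M ω a b) :
    ∃ V : ℝ → H →L[ℂ] H, IsC0Semigroup V ∧ IsGenerator (A + B) V ∧
      ContinuousOn V (Set.Ioi 0) ∧ ∀ t, 0 < t → V t = U t - volterra V T t := by
  have hU := h.isC0Semigroup
  obtain ⟨l₀, hl₀⟩ := eventually_atTop.1
    (h.tendsto_integral_norm_rescale.eventually (Iio_mem_nhds one_pos))
  set l := max l₀ (ω + 1) with hldef
  have hlω : ω < l := lt_of_lt_of_le (by linarith) (le_max_right _ _)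
  have hτ := h.integrableOn hlω
  have hq : ∫ t in Set.Ioi 0, ‖rescale l T t‖ < 1 := hl₀ l (le_max_left _ _)
  have hM := h.hasGrowth.nonneg
  obtain ⟨v', hv'c, ⟨C, hv'C⟩, hv'u⟩ := exists_eq_sub_volterra (u := rescale l U)
    (τ := rescale l T) (M := M) (continuousOn_rescale h.hasGrowth.continuousOn l)
    (fun t ht => (h.hasGrowth.norm_rescale_le l ht).trans (mul_le_of_le_one_right hM
      (Real.exp_le_one_iff.2 (mul_nonpos_of_nonpos_of_nonneg (by linarith) ht.le)))) hτ hq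
  -- Only the values on `(0, ∞)` matter for the Volterra equation; put `v 0 = 1`.
  set v : ℝ → H →L[ℂ] H := Function.update v' 0 1 with hvdef
  have hvv : ∀ t, 0 < t → v t = v' t := fun t ht => Function.update_of_ne ht.ne' _ _
  have hvc : ContinuousOn v (Set.Ioi 0) := hv'c.congr hvv
  have hvC : ∀ t, 0 < t → ‖v t‖ ≤ C := fun t ht => by rw [hvv t ht]; exact hv'C t ht
  have hvu : ∀ t, 0 < t → v t = rescale l U t - volterra v (rescale l T) t := by
    intro t ht
    rw [hvv t ht, hv'u t ht]
    congr 1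
    refine setIntegral_congr_fun measurableSet_Ioo fun s hs => ?_
    simp only [hvv (t - s) (sub_pos.2 hs.2)]
  have hv : IsC0Semigroup v := isC0Semigroup_of_eq_sub_volterra (hU.rescale l)
    (fun s t hs ht => rescale_add (h.map_add hs ht.le) l) hτ hq hvc hvC hvu
    (Function.update_self _ _ _)
  have hgen : ∀ {x y w}, (x, y) ∈ A.graph → (x, w) ∈ B.graph →
      HasGenValue v x (y + w + l • x) := by
    intro x y w hy hw
    have hw' : Tendsto (fun t => rescale l T t x) (𝓝[>] 0) (𝓝 w) := by
      have h1 : Tendsto (fun t : ℝ => Real.exp (-(l * t))) (𝓝[>] 0) (𝓝 1) := by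
        have : Continuous fun t : ℝ => Real.exp (-(l * t)) := by fun_prop
        simpa using (this.tendsto 0).mono_left nhdsWithin_le_nhds
      simpa using! h1.smul (h.tendsto_apply hy hw)
    have := hasGenValue_of_eq_sub_volterra hτ hv hvc hvC hvu
      ((h.isGenerator.mem_graph_iff.1 hy).rescale l) hw'
    rwa [add_right_comm] at this
  refine ⟨rescale (-l) v, hv.rescale _, isGenerator_iff.2 fun x z => ⟨?_, ?_⟩,
    continuousOn_rescale hvc _, fun t ht => ?_⟩
  · rintro hz
    obtain ⟨y, w, hy, hw, rfl⟩ := mem_graph_add_iff.1 hz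
    simpa using (hgen hy hw).rescale (-l)
  · intro hz
    have hz1 : HasGenValue v x (z + l • x) := by
      have := hz.rescale l
      rwa [show rescale l (rescale (-l) v) = v by simpa using rescale_neg_rescale (-l) v] at this
    -- Solve `(A + B + l + 1) u = z + (l + 1) x` by a Neumann series.
    have hl1 : ω < l + 1 := by linarith
    set R := laplace U (l + 1)
    set K := laplace T (l + 1)
    have hK : ‖K‖ < 1 := lt_of_le_of_lt (norm_integral_le_integral_norm _)
      (hl₀ (l + 1) ((le_max_left _ _).trans (by linarith)))
    obtain ⟨S, hS⟩ := isUnit_one_sub_of_norm_lt_one (x := -K) (by rwa [norm_neg])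
    set g := z + (l + 1) • x with hg
    obtain ⟨p, hp⟩ : ∃ p, p + K p = g := by
      refine ⟨(↑S⁻¹ : H →L[ℂ] H) g, ?_⟩
      have := DFunLike.congr_fun (S.mul_inv) g
      rw [hS, sub_neg_eq_add] at this
      exact this
    have hRA : (R p, p - (l + 1) • R p) ∈ A.graph :=
      h.isGenerator.mem_graph_iff.2 (h.hasGrowth.hasGenValue_laplace hU hl1 p)
    have hRB : (R p, K p) ∈ B.graph := h.mem_graph_laplace hl1 p
    have h1 := (hz1.sub (hgen hRA hRB)).rescale 1
    have h2 : z + l • x - (p - (l + 1) • R p + K p + l • R p) + (1 : ℝ) • (x - R p) = 0 := by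
      have e : z = p + K p - (l + 1) • x := by rw [hp, hg, add_sub_cancel_right]
      rw [e]
      module
    rw [h2] at h1
    have hlim : Tendsto (fun t => ‖rescale 1 v t‖) atTop (𝓝 0) := by
      have hgv : HasGrowth v C 0 := ⟨hvc, fun t ht => by simpa using hvC t ht⟩
      exact hgv.tendsto_norm_rescale one_pos
    have hx : x = R p := sub_eq_zero.1 ((hv.rescale 1).eq_zero_of_hasGenValue_zero h1 hlim)
    refine mem_graph_add_iff.2 ⟨_, _, hx ▸ hRA, hx ▸ hRB, ?_⟩
    rw [sub_add_eq_add_sub, hp, hg, add_sub_cancel_right]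
  · have e1 : rescale (-l) (rescale l U) t = U t := by rw [rescale_neg_rescale]
    have e2 : rescale (-l) (fun t => volterra v (rescale l T) t) t =
        volterra (rescale (-l) v) T t := by
      rw [rescale, volterra, volterra, ← integral_smul]
      refine setIntegral_congr_fun measurableSet_Ioo fun s _ => ?_
      simp only [rescale, mul_smul_comm, smul_mul_assoc, smul_smul, ← Real.exp_add]
      congr 2
      ring
    rw [← e1, ← e2]
    simp only [rescale]
    rw [← smul_sub]
    congr 1
    exact hvu t ht

end Perturbation

/-! ### The trace norm -/

section TraceNorm

open ContinuousLinearMap Module.End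

universe u

variable {H : Type u} [NormedAddCommGroup H] [InnerProductSpace ℂ H] [CompleteSpace H]

theorem inner_adjoint_comp_self (K : H →L[ℂ] H) (x y : H) :
    ⟪x, (adjoint K ∘L K : H →L[ℂ] H) y⟫_ℂ = ⟪K x, K y⟫_ℂ := by
  rw [ContinuousLinearMap.comp_apply, adjoint_inner_right]

/-- If `x` is orthogonal to the eigenvectors of `K* K` for positive eigenvalues, then `K x = 0`:
the component of `x` orthogonal to `ker K` is orthogonal to all eigenspaces of `K* K`. -/
theorem apply_eq_zero_of_orthogonal {K : H →L[ℂ] H} (hK : IsCompactOperator K) {x : H}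
    (hx : ∀ μ : ℝ, 0 < μ → ∀ y,
      y ∈ eigenspace ((adjoint K ∘L K : H →L[ℂ] H) : Module.End ℂ H) (μ : ℂ) → ⟪y, x⟫_ℂ = 0) :
    K x = 0 := by
  set T : H →L[ℂ] H := adjoint K ∘L K with hT
  have hTc : IsCompactOperator T := hK.clm_comp (adjoint K)
  have hTs : (T : H →ₗ[ℂ] H).IsSymmetric := (isPositive_adjoint_comp_self K).isSymmetric
  set N : Submodule ℂ H := LinearMap.ker (K : H →ₗ[ℂ] H) with hN
  have hNc : IsClosed (N : Set H) := K.isClosed_ker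
  have : CompleteSpace N := hNc.completeSpace_coe
  obtain ⟨x₀, hx₀, x₁, hx₁, rfl⟩ := N.exists_add_mem_mem_orthogonal x
  have hKx₀ : K x₀ = 0 := hx₀
  suffices h1 : x₁ = 0 by rw [h1, add_zero, hKx₀]
  have hbot := orthogonalComplement_iSup_eigenspaces_eq_bot hTc hTs
  rw [← Submodule.mem_bot ℂ, ← hbot, ← Submodule.iInf_orthogonal, Submodule.mem_iInf]
  intro ν y hy
  have hTy : T y = ν • y := mem_eigenspace_iff.1 hy
  have hy2 : ν * ⟪y, y⟫_ℂ = ⟪K y, K y⟫_ℂ := by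
    rw [← inner_adjoint_comp_self, ← hT, hTy, inner_smul_right]
  by_cases hy0 : K y = 0
  · exact hx₁ y hy0
  -- Otherwise `ν` is a positive real number.
  have hyne : y ≠ 0 := fun h => hy0 (by rw [h, map_zero])
  have hν : ν = ((‖K y‖ ^ 2 / ‖y‖ ^ 2 : ℝ) : ℂ) := by
    have hne : (‖y‖ : ℂ) ≠ 0 := by simpa using hyne
    rw [inner_self_eq_norm_sq_to_K, inner_self_eq_norm_sq_to_K] at hy2
    push_cast
    rw [eq_div_iff (pow_ne_zero 2 hne)]
    exact hy2
  have hpos : 0 < ‖K y‖ ^ 2 / ‖y‖ ^ 2 := by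
    have := norm_pos_iff.2 hy0
    have := norm_pos_iff.2 hyne
    positivity
  have h2 := hx _ hpos y (hν ▸ hy)
  have hν0 : ν ≠ 0 := by
    rw [hν]
    exact_mod_cast hpos.ne'
  have h3 : ⟪y, x₀⟫_ℂ = 0 := by
    have h4 : ν * ⟪x₀, y⟫_ℂ = 0 := by
      rw [← inner_smul_right, ← hTy, hT, inner_adjoint_comp_self, hKx₀, inner_zero_left]
    exact inner_eq_zero_symm.1 ((mul_eq_zero.1 h4).resolve_left hν0)
  rwa [inner_add_right, h3, zero_add] at h2

/-- The singular value decomposition of a compact operator: there is an orthonormal basis whose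
vectors `K` maps to pairwise orthogonal vectors, the norms of which are the singular values. -/
theorem exists_hilbertBasis_schattenNorm_eq {K : H →L[ℂ] H} (hK : IsCompactOperator K) :
    ∃ (w : Set H) (b : HilbertBasis w ℂ H), (∀ i j, i ≠ j → ⟪K (b i), K (b j)⟫_ℂ = 0) ∧
      schattenNorm 1 K = ∑' i, ‖K (b i)‖ₑ := by
  set T : H →L[ℂ] H := adjoint K ∘L K with hT
  have hTc : IsCompactOperator T := hK.clm_comp (adjoint K)
  have hTs : (T : H →ₗ[ℂ] H).IsSymmetric := (isPositive_adjoint_comp_self K).isSymmetric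
  let P := {μ : ℝ // 0 < μ}
  let E : P → Submodule ℂ H := fun μ => eigenspace (T : Module.End ℂ H) ((μ : ℝ) : ℂ)
  have hfin : ∀ μ : P, FiniteDimensional ℂ (E μ) := fun μ =>
    finite_dimensional_eigenspace hTc _ (by exact_mod_cast μ.2.ne')
  have hinj : Function.Injective fun μ : P => ((μ : ℝ) : ℂ) := fun μ ν h =>
    Subtype.ext (Complex.ofReal_injective h)
  have hortho : OrthogonalFamily ℂ (fun μ : P => E μ) fun μ => (E μ).subtypeₗᵢ :=
    (hTs.orthogonalFamily_eigenspaces).comp hinj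
  let e : (Σ μ : P, Fin (Module.finrank ℂ (E μ))) → H :=
    fun p => (stdOrthonormalBasis ℂ (E p.1) p.2 : H)
  have he : Orthonormal ℂ e := hortho.orthonormal_sigma_orthonormal
    fun μ => (stdOrthonormalBasis ℂ (E μ)).orthonormal
  have hTe : ∀ p, T (e p) = ((p.1 : ℝ) : ℂ) • e p := fun p =>
    mem_eigenspace_iff.1 (stdOrthonormalBasis ℂ (E p.1) p.2).2
  have hKe : ∀ p, ‖K (e p)‖ = √(p.1 : ℝ) := by
    intro p
    rw [eq_comm, Real.sqrt_eq_iff_eq_sq p.1.2.le (norm_nonneg _)]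
    have h1 := inner_adjoint_comp_self K (e p) (e p)
    rw [← hT, hTe, inner_smul_right, inner_self_eq_norm_sq_to_K, inner_self_eq_norm_sq_to_K,
      he.norm_eq_one p] at h1
    have h2 : (((p.1 : ℝ) : ℝ) : ℂ) = ((‖K (e p)‖ ^ 2 : ℝ) : ℂ) := by
      push_cast
      simpa using h1
    exact_mod_cast h2
  obtain ⟨w, b, hsw, hb⟩ := he.toSubtypeRange.exists_hilbertBasis_extension
  have hbi : ∀ i, b i = (i : H) := fun i => congrFun hb i
  have hbe : ∀ p, b ⟨e p, hsw ⟨p, rfl⟩⟩ = e p := fun p => hbi _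
  have hzero : ∀ i : w, (i : H) ∉ Set.range e → K (b i) = 0 := by
    intro i hi
    refine apply_eq_zero_of_orthogonal hK fun μ hμ y hy => ?_
    have hy' : y ∈ E ⟨μ, hμ⟩ := hy
    have hsum := (stdOrthonormalBasis ℂ (E ⟨μ, hμ⟩)).sum_repr ⟨y, hy'⟩
    have hsum' := congrArg (fun z : E ⟨μ, hμ⟩ => (z : H)) hsum
    simp only [Submodule.coe_sum, Submodule.coe_smul] at hsum'
    rw [← hsum', sum_inner]
    refine Finset.sum_eq_zero fun k _ => ?_
    rw [inner_smul_left]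
    have hne : (⟨e ⟨⟨μ, hμ⟩, k⟩, hsw ⟨_, rfl⟩⟩ : w) ≠ i := fun h => hi ⟨⟨⟨μ, hμ⟩, k⟩, by rw [← h]⟩
    have : ⟪b ⟨e ⟨⟨μ, hμ⟩, k⟩, hsw ⟨_, rfl⟩⟩, b i⟫_ℂ = 0 := b.orthonormal.2 hne
    rw [hbe] at this
    rw [show ((stdOrthonormalBasis ℂ (E ⟨μ, hμ⟩) k : E ⟨μ, hμ⟩) : H) = e ⟨⟨μ, hμ⟩, k⟩ from rfl,
      this, mul_zero]
  refine ⟨w, b, fun i j hij => ?_, ?_⟩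
  · by_cases hj : (j : H) ∈ Set.range e
    · obtain ⟨p, hp⟩ := hj
      have hj' : b j = e p := by rw [hbi, hp]
      rw [← inner_adjoint_comp_self, ← hT, hj', hTe, inner_smul_right, ← hj',
        b.orthonormal.2 hij, mul_zero]
    · rw [hzero j hj, inner_zero_right]
  · have hg : Function.Injective
        fun p => (⟨e p, hsw ⟨p, rfl⟩⟩ : w) := fun p q h =>
      he.linearIndependent.injective (congrArg Subtype.val h)
    rw [← hg.tsum_eq]
    · have h1 : ∀ p, ‖K (b ⟨e p, hsw ⟨p, rfl⟩⟩)‖ₑ = ENNReal.ofReal √(p.1 : ℝ) := fun p => by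
        rw [hbe, ← hKe p, ofReal_norm]
      simp_rw [h1]
      rw [ENNReal.tsum_sigma fun (μ : P) (_ : Fin (Module.finrank ℂ (E μ))) =>
        ENNReal.ofReal √(μ : ℝ)]
      rw [schattenNorm, if_pos hK]
      simp only [div_one, ENNReal.rpow_one, tsum_fintype, Finset.sum_const, Finset.card_univ,
        Fintype.card_fin, nsmul_eq_mul]
      rfl
    · intro i hi
      by_contra hcon
      refine hi ?_
      have : (i : H) ∉ Set.range e := fun ⟨p, hp⟩ => hcon ⟨p, Subtype.ext hp⟩
      simp only [hzero i this, enorm_zero]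

/-- The trace norm of a compact operator is attained in the duality with pairs of orthonormal
families. -/
theorem exists_schattenNorm_eq_tsum_inner {K : H →L[ℂ] H} (hK : IsCompactOperator K) :
    ∃ (ι : Type u) (g h : ι → H), Orthonormal ℂ g ∧ Orthonormal ℂ h ∧
      schattenNorm 1 K = ∑' i, ‖⟪h i, K (g i)⟫_ℂ‖ₑ := by
  obtain ⟨w, b, hb, hsum⟩ := exists_hilbertBasis_schattenNorm_eq hK
  let s : Set w := {i | K (b i) ≠ 0}
  have hs : ∀ i : s, (‖K (b i)‖ : ℂ) ≠ 0 := fun i => by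
    simpa only [ne_eq, Complex.ofReal_eq_zero, norm_eq_zero] using! i.2
  refine ⟨s, fun i => b i, fun i => (‖K (b i)‖ : ℂ)⁻¹ • K (b i),
    b.orthonormal.comp _ Subtype.val_injective, ⟨fun i => ?_, fun i j hij => ?_⟩, ?_⟩
  · have := hs i
    rw [norm_smul, norm_inv, Complex.norm_real, norm_norm, inv_mul_cancel₀]
    exact_mod_cast this
  · simp only
    rw [inner_smul_left, inner_smul_right, hb _ _ fun h => hij (Subtype.ext h), mul_zero, mul_zero]
  · rw [hsum, ← tsum_subtype_eq_of_support_subset (s := s) (f := fun i => ‖K (b i)‖ₑ)]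
    · refine tsum_congr fun i => ?_
      have hi := hs i
      rw [inner_smul_left, inner_self_eq_norm_sq_to_K, map_inv₀, Complex.conj_ofReal, pow_two]
      have : (‖K (b i)‖ : ℂ)⁻¹ * ((‖K (b i)‖ : ℂ) * (‖K (b i)‖ : ℂ)) = ‖K (b i)‖ :=
        inv_mul_cancel_left₀ hi _
      erw [this]
      rw [← ofReal_norm, ← ofReal_norm, Complex.norm_real, norm_norm]
    · intro i hi
      simpa [s] using hi

/-- The Cauchy–Schwarz and Bessel inequalities combined. -/
theorem tsum_enorm_inner_mul_enorm_inner_le {ι : Type*} {g h : ι → H} (hg : Orthonormal ℂ g)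
    (hh : Orthonormal ℂ h) (x y : H) :
    ∑' j, ‖⟪x, g j⟫_ℂ‖ₑ * ‖⟪h j, y⟫_ℂ‖ₑ ≤ ‖x‖ₑ * ‖y‖ₑ := by
  rw [ENNReal.tsum_eq_iSup_sum]
  refine iSup_le fun s => ?_
  have h1 : ∑ j ∈ s, ‖⟪x, g j⟫_ℂ‖ * ‖⟪h j, y⟫_ℂ‖ ≤ ‖x‖ * ‖y‖ := by
    refine (Real.sum_mul_le_sqrt_mul_sqrt s _ _).trans ?_
    have e1 : ∑ j ∈ s, ‖⟪x, g j⟫_ℂ‖ ^ 2 ≤ ‖x‖ ^ 2 := by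
      simp_rw [norm_inner_symm x]
      exact hg.sum_inner_products_le x
    have e2 : ∑ j ∈ s, ‖⟪h j, y⟫_ℂ‖ ^ 2 ≤ ‖y‖ ^ 2 := hh.sum_inner_products_le y
    exact mul_le_mul (Real.sqrt_le_iff.2 ⟨norm_nonneg _, e1⟩)
      (Real.sqrt_le_iff.2 ⟨norm_nonneg _, e2⟩) (Real.sqrt_nonneg _) (norm_nonneg _)
  have h2 := ENNReal.ofReal_le_ofReal h1
  rw [ENNReal.ofReal_sum_of_nonneg fun _ _ => by positivity] at h2
  simpa only [ENNReal.ofReal_mul (norm_nonneg _), ofReal_norm] using h2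

theorem apply_eq_tsum {ι : Type*} (b : HilbertBasis ι ℂ H) (K : H →L[ℂ] H) (x : H) :
    K x = ∑' i, ⟪b i, x⟫_ℂ • K (b i) := by
  have := (b.hasSum_repr x).mapL K
  simp only [b.repr_apply_apply, map_smul] at this
  exact this.tsum_eq.symm

/-- The duality bound behind the ideal property: expand `K gⱼ` in the singular value decomposition of
`K`, and apply Bessel's inequality to each singular value. -/
theorem tsum_enorm_inner_mul_le {ι : Type*} {g h : ι → H} (hg : Orthonormal ℂ g)
    (hh : Orthonormal ℂ h) (S K : H →L[ℂ] H) :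
    ∑' j, ‖⟪h j, S (K (g j))⟫_ℂ‖ₑ ≤ ‖S‖ₑ * schattenNorm 1 K := by
  by_cases hK : IsCompactOperator K
  swap
  · rw [schattenNorm, if_neg hK]
    by_cases hS : S = 0
    · simp [hS]
    · rw [ENNReal.mul_top (by simpa using hS)]
      exact le_top
  obtain ⟨w, b, -, hsum⟩ := exists_hilbertBasis_schattenNorm_eq hK
  have h1 : ∀ j, ‖⟪h j, S (K (g j))⟫_ℂ‖ₑ ≤
      ∑' i, ‖⟪b i, g j⟫_ℂ‖ₑ * ‖⟪h j, S (K (b i))⟫_ℂ‖ₑ := by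
    intro j
    have e : ⟪h j, S (K (g j))⟫_ℂ = ∑' i, ⟪b i, g j⟫_ℂ * ⟪h j, S (K (b i))⟫_ℂ := by
      have hs : HasSum (fun i => ⟪b i, g j⟫_ℂ • b i) (g j) := by
        simpa only [b.repr_apply_apply] using b.hasSum_repr (g j)
      have := hs.mapL (innerSL ℂ (h j) ∘L (S ∘L K))
      simp only [map_smul, ContinuousLinearMap.comp_apply, innerSL_apply_apply, smul_eq_mul] at this
      exact this.tsum_eq.symm
    rw [e]
    refine enorm_tsum_le_tsum_enorm.trans (le_of_eq (tsum_congr fun i => ?_))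
    rw [enorm_mul]
  calc ∑' j, ‖⟪h j, S (K (g j))⟫_ℂ‖ₑ
      ≤ ∑' j, ∑' i, ‖⟪b i, g j⟫_ℂ‖ₑ * ‖⟪h j, S (K (b i))⟫_ℂ‖ₑ := ENNReal.tsum_le_tsum h1
    _ = ∑' i, ∑' j, ‖⟪b i, g j⟫_ℂ‖ₑ * ‖⟪h j, S (K (b i))⟫_ℂ‖ₑ := ENNReal.tsum_comm
    _ ≤ ∑' i, ‖S‖ₑ * ‖K (b i)‖ₑ := by
        refine ENNReal.tsum_le_tsum fun i => ?_
        refine (tsum_enorm_inner_mul_enorm_inner_le hg hh _ _).trans ?_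
        rw [show ‖b i‖ₑ = 1 by rw [← ofReal_norm, b.orthonormal.norm_eq_one, ENNReal.ofReal_one],
          one_mul]
        exact S.le_opENorm _
    _ = ‖S‖ₑ * schattenNorm 1 K := by rw [ENNReal.tsum_mul_left, hsum]

theorem tsum_enorm_inner_le {ι : Type*} {g h : ι → H} (hg : Orthonormal ℂ g)
    (hh : Orthonormal ℂ h) (K : H →L[ℂ] H) :
    ∑' j, ‖⟪h j, K (g j)⟫_ℂ‖ₑ ≤ schattenNorm 1 K := by
  have h1 := tsum_enorm_inner_mul_le hg hh (ContinuousLinearMap.id ℂ H) K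
  refine h1.trans (mul_le_of_le_one_left zero_le ?_)
  rw [← ofReal_norm]
  exact ENNReal.ofReal_le_one.2 ContinuousLinearMap.norm_id_le

theorem IsSchatten.isCompactOperator {p : ℝ} {K : H →L[ℂ] H} (h : IsSchatten p K) :
    IsCompactOperator K := by
  by_contra hK
  rw [IsSchatten, schattenNorm, if_neg hK] at h
  exact lt_irrefl _ h

/-- The left ideal property of the trace class. -/
theorem schattenNorm_mul_le {K : H →L[ℂ] H} (hK : IsCompactOperator K) (S : H →L[ℂ] H) :
    schattenNorm 1 (S * K) ≤ ‖S‖ₑ * schattenNorm 1 K := by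
  obtain ⟨ι, g, h, hg, hh, e⟩ := exists_schattenNorm_eq_tsum_inner
    (K := S * K) (hK.clm_comp S)
  rw [e]
  exact tsum_enorm_inner_mul_le hg hh S K

theorem schattenNorm_add_le {K L : H →L[ℂ] H} (hK : IsCompactOperator K)
    (hL : IsCompactOperator L) :
    schattenNorm 1 (K + L) ≤ schattenNorm 1 K + schattenNorm 1 L := by
  obtain ⟨ι, g, h, hg, hh, e⟩ := exists_schattenNorm_eq_tsum_inner (K := K + L) (hK.add hL)
  rw [e]
  refine le_trans ?_ (add_le_add (tsum_enorm_inner_le hg hh K) (tsum_enorm_inner_le hg hh L))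
  rw [← ENNReal.tsum_add]
  refine ENNReal.tsum_le_tsum fun i => ?_
  rw [add_apply, inner_add_right]
  exact enorm_add_le _ _

theorem schattenNorm_neg (p : ℝ) (K : H →L[ℂ] H) : schattenNorm p (-K) = schattenNorm p K := by
  have h1 : adjoint (-K) ∘L (-K) = adjoint K ∘L K := by
    rw [_root_.map_neg, ContinuousLinearMap.neg_comp, ContinuousLinearMap.comp_neg, neg_neg]
  have h2 : IsCompactOperator ⇑(-K : H →L[ℂ] H) ↔ IsCompactOperator K :=
    ⟨fun h => by simpa using! h.neg, fun h => h.neg⟩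
  rw [schattenNorm, schattenNorm]
  by_cases hK : IsCompactOperator K
  · rw [if_pos hK, if_pos (h2.2 hK), h1]
  · rw [if_neg hK, if_neg (mt h2.1 hK)]

theorem enorm_le_schattenNorm (K : H →L[ℂ] H) : ‖K‖ₑ ≤ schattenNorm 1 K := by
  by_cases hK : IsCompactOperator K
  swap
  · rw [schattenNorm, if_neg hK]
    exact le_top
  obtain ⟨w, b, -, hsum⟩ := exists_hilbertBasis_schattenNorm_eq hK
  refine K.opENorm_le_bound fun x => ?_
  rw [apply_eq_tsum b K x, hsum, ← ENNReal.tsum_mul_right]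
  refine enorm_tsum_le_tsum_enorm.trans (ENNReal.tsum_le_tsum fun i => ?_)
  rw [enorm_smul, mul_comm]
  gcongr
  rw [← ofReal_norm, ← ofReal_norm]
  refine ENNReal.ofReal_le_ofReal ((norm_inner_le_norm _ _).trans ?_)
  rw [b.orthonormal.norm_eq_one, one_mul]

theorem isCompactOperator_integral {α : Type*} [MeasurableSpace α] {m : Measure α}
    {F : α → H →L[ℂ] H} (hF : Integrable F m) (hFc : ∀ᵐ t ∂m, IsCompactOperator (F t)) :
    IsCompactOperator ⇑(∫ t, F t ∂m : H →L[ℂ] H) := by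
  let S : Submodule ℂ (H →L[ℂ] H) := compactOperator (RingHom.id ℂ) H H
  have hS : IsClosed (S : Set (H →L[ℂ] H)) := isClosed_setOfPred_isCompactOperator
  have h1 : S.mkQL (∫ t, F t ∂m) = 0 := by
    rw [← ContinuousLinearMap.integral_comp_comm _ hF]
    refine integral_eq_zero_of_ae ?_
    filter_upwards [hFc] with t ht
    exact (Submodule.Quotient.mk_eq_zero S).2 ht
  exact (Submodule.Quotient.mk_eq_zero S).1 h1

/-- Minkowski's inequality for the trace norm. No measurability of `t ↦ ‖F t‖₁` is needed, since
only the functions `t ↦ ⟪h, F t g⟫` are integrated. -/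
theorem schattenNorm_integral_le {α : Type*} [MeasurableSpace α] {m : Measure α}
    {F : α → H →L[ℂ] H} (hF : Integrable F m) (hFc : ∀ᵐ t ∂m, IsCompactOperator (F t)) :
    schattenNorm 1 (∫ t, F t ∂m) ≤ ∫⁻ t, schattenNorm 1 (F t) ∂m := by
  obtain ⟨ι, g, h, hg, hh, e⟩ := exists_schattenNorm_eq_tsum_inner
    (isCompactOperator_integral hF hFc)
  rw [e, ENNReal.tsum_eq_iSup_sum]
  refine iSup_le fun s => ?_
  have hI : ∀ i, Integrable (fun t => ⟪h i, F t (g i)⟫_ℂ) m := fun i =>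
    (innerSL ℂ (h i)).integrable_comp (hF.apply_continuousLinearMap (g i))
  calc ∑ i ∈ s, ‖⟪h i, (∫ t, F t ∂m) (g i)⟫_ℂ‖ₑ
      ≤ ∑ i ∈ s, ∫⁻ t, ‖⟪h i, F t (g i)⟫_ℂ‖ₑ ∂m := by
        refine Finset.sum_le_sum fun i _ => ?_
        rw [ContinuousLinearMap.integral_apply hF,
          ← integral_inner (hF.apply_continuousLinearMap (g i))]
        exact enorm_integral_le_lintegral_enorm _
    _ = ∫⁻ t, ∑ i ∈ s, ‖⟪h i, F t (g i)⟫_ℂ‖ₑ ∂m :=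
        (lintegral_finsetSum' s fun i _ => (hI i).1.enorm).symm
    _ ≤ ∫⁻ t, schattenNorm 1 (F t) ∂m := by
        refine lintegral_mono fun t => ?_
        exact (ENNReal.sum_le_tsum s).trans (tsum_enorm_inner_le hg hh (F t))

end TraceNorm

/-! ### The trace norm of the perturbed semigroup -/

section Asymptotic

variable {H : Type*} [NormedAddCommGroup H] [InnerProductSpace ℂ H] [CompleteSpace H]
variable {A B : H →ₗ.[ℂ] H} {U T V : ℝ → H →L[ℂ] H} {M ω a b : ℝ}

theorem traceNorm_nonneg (K : H →L[ℂ] H) : 0 ≤ traceNorm K := ENNReal.toReal_nonneg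

theorem abs_traceNorm_sub_le {K L : H →L[ℂ] H} (hK : IsSchatten 1 K) (hL : IsSchatten 1 L) :
    |traceNorm K - traceNorm L| ≤ traceNorm (K - L) := by
  have key : ∀ {K L : H →L[ℂ] H}, IsSchatten 1 K → IsSchatten 1 L →
      traceNorm K ≤ traceNorm (K - L) + traceNorm L := by
    intro K L hK hL
    have hc : IsCompactOperator ⇑(K - L : H →L[ℂ] H) :=
      hK.isCompactOperator.sub hL.isCompactOperator
    have hlt : schattenNorm 1 (K - L) < ⊤ := by
      have h := schattenNorm_add_le (K := K) (L := -L) hK.isCompactOperator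
        hL.isCompactOperator.neg
      rw [← sub_eq_add_neg, schattenNorm_neg] at h
      exact h.trans_lt (ENNReal.add_lt_top.2 ⟨hK, hL⟩)
    have h := schattenNorm_add_le hc hL.isCompactOperator
    rw [sub_add_cancel] at h
    rw [traceNorm, traceNorm, traceNorm, ← ENNReal.toReal_add hlt.ne hL.ne]
    exact ENNReal.toReal_mono (ENNReal.add_lt_top.2 ⟨hlt, hL⟩).ne h
  have h1 := key hK hL
  have h2 := key hL hK
  have h3 : traceNorm (L - K) = traceNorm (K - L) := by
    rw [traceNorm, traceNorm, ← schattenNorm_neg, neg_sub]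
  rw [abs_le]
  constructor <;> linarith

/-- The Volterra equation bounds the trace norm of `V t - U t` by the mass of `‖T‖₁` near zero. -/
theorem schattenNorm_sub_le_of_volterra (hTc : ContinuousOn T (Set.Ioi 0))
    (hTi : (∫⁻ s in Set.Ioo (0 : ℝ) 1, ‖T s‖ₑ) < ⊤) (hTs : ∀ t, 0 < t → IsSchatten 1 (T t))
    (hVc : ContinuousOn V (Set.Ioi 0)) {C : ℝ} (hVC : ∀ t, 0 ≤ t → t ≤ 1 → ‖V t‖ ≤ C)
    (hVU : ∀ t, 0 < t → V t = U t - volterra V T t) {t : ℝ} (ht : 0 < t) (ht1 : t ≤ 1) :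
    IsCompactOperator ⇑(V t - U t : H →L[ℂ] H) ∧
      schattenNorm 1 (V t - U t) ≤ ENNReal.ofReal C * ∫⁻ s in Set.Ioo 0 t, schattenNorm 1 (T s) := by
  have hsub : Set.Ioo 0 t ⊆ Set.Ioo (0 : ℝ) 1 := Set.Ioo_subset_Ioo_right ht1
  have hT : IntegrableOn T (Set.Ioo 0 t) :=
    IntegrableOn.mono_set ⟨(hTc.mono Set.Ioo_subset_Ioi_self).aestronglyMeasurable
      measurableSet_Ioo, hTi⟩ hsub
  have hVt : ContinuousOn (fun s => V (t - s)) (Set.Ioo 0 t) :=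
    hVc.comp (by fun_prop) fun s hs => sub_pos.2 hs.2
  have hC : ∀ s ∈ Set.Ioo 0 t, ‖V (t - s)‖ ≤ C := fun s hs =>
    hVC _ (sub_nonneg.2 hs.2.le) (by linarith [hs.1])
  have hF : IntegrableOn (fun s => V (t - s) * T s) (Set.Ioo 0 t) :=
    hT.bdd_mul (hVt.aestronglyMeasurable measurableSet_Ioo)
      ((ae_restrict_iff' measurableSet_Ioo).2 (ae_of_all _ hC))
  have hFc : ∀ s ∈ Set.Ioo 0 t, IsCompactOperator ⇑(V (t - s) * T s : H →L[ℂ] H) := fun s hs =>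
    (hTs s hs.1).isCompactOperator.clm_comp (V (t - s))
  have hFc' := (ae_restrict_iff' (μ := volume) measurableSet_Ioo).2 (ae_of_all _ hFc)
  have e : V t - U t = - volterra V T t := by rw [hVU t ht]; abel
  rw [e, schattenNorm_neg]
  refine ⟨(isCompactOperator_integral hF hFc').neg, ?_⟩
  refine (schattenNorm_integral_le hF hFc').trans ?_
  rw [← lintegral_const_mul' _ _ ENNReal.ofReal_ne_top]
  refine setLIntegral_mono' measurableSet_Ioo fun s hs => ?_
  refine (schattenNorm_mul_le (hTs s hs.1).isCompactOperator _).trans ?_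
  gcongr
  rw [← ofReal_norm]
  exact ENNReal.ofReal_le_ofReal (hC s hs)

theorem IsC0Semigroup.eventually_le_norm [Nontrivial H] (hU : IsC0Semigroup U) :
    ∀ᶠ t in 𝓝[>] (0 : ℝ), 1 / 2 ≤ ‖U t‖ := by
  obtain ⟨x, hx⟩ := exists_ne (0 : H)
  have hx0 : 0 < ‖x‖ := norm_pos_iff.2 hx
  filter_upwards [(hU.tendsto_zero x).norm.eventually
    (Ioi_mem_nhds (show ‖x‖ / 2 < ‖x‖ by linarith))] with t ht
  have h1 : ‖x‖ / 2 < ‖U t x‖ := ht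
  have h2 := (U t).le_opNorm x
  by_contra! h
  nlinarith

/-- If `‖V t - U t‖₁ → 0`, the trace norms of `V t` and `U t` are asymptotically equal, since
`‖U t‖₁ ≥ ‖U t‖` is bounded below unless the space is trivial. -/
theorem traceNorm_isEquivalent (hU : IsGibbsSemigroup U)
    (hV : ∀ t, 0 < t → IsSchatten 1 (V t))
    (h : Tendsto (fun t => schattenNorm 1 (V t - U t)) (𝓝[>] 0) (𝓝 0)) :
    (fun t => traceNorm (V t)) ~[𝓝[>] 0] (fun t => traceNorm (U t)) := by
  rcases subsingleton_or_nontrivial H with hH | hH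
  · have : V = U := by
      ext t x
      exact Subsingleton.elim _ _
    rw [this]
  have h0 : Tendsto (fun t => traceNorm (V t - U t)) (𝓝[>] 0) (𝓝 0) := by
    simpa [traceNorm] using! (ENNReal.tendsto_toReal ENNReal.zero_ne_top).comp h
  have h1 : (fun t => traceNorm (V t) - traceNorm (U t)) =O[𝓝[>] 0]
      fun t => traceNorm (V t - U t) := by
    refine IsBigO.of_bound 1 ?_
    filter_upwards [self_mem_nhdsWithin] with t ht
    rw [one_mul, Real.norm_eq_abs, Real.norm_eq_abs, abs_of_nonneg (traceNorm_nonneg (V t - U t))]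
    exact abs_traceNorm_sub_le (hV t ht) (hU.isSchatten t ht)
  have h2 : (fun _ => (1 : ℝ)) =O[𝓝[>] 0] fun t => traceNorm (U t) := by
    refine IsBigO.of_bound 2 ?_
    filter_upwards [hU.isC0Semigroup.eventually_le_norm, self_mem_nhdsWithin] with t ht ht0
    rw [norm_one, Real.norm_eq_abs, abs_of_nonneg (traceNorm_nonneg _)]
    have h3 : ‖U t‖ ≤ traceNorm (U t) := by
      have := ENNReal.toReal_mono (hU.isSchatten t ht0).ne (enorm_le_schattenNorm (U t))
      rwa [toReal_enorm] at this
    linarith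
  exact h1.trans_isLittleO (((isLittleO_one_iff ℝ).2 h0).trans_isBigO h2)

theorem MemClass.exists_isPerturbation (hU : IsGibbsSemigroup U) (hA : IsGenerator A U)
    (hB : MemClass 1 A U B) : ∃ (T : ℝ → H →L[ℂ] H) (M ω a b : ℝ),
      IsPerturbation A B U T M ω a b ∧ (∀ t : ℝ, 0 < t → IsSchatten 1 (T t)) ∧
        (∫⁻ s in Set.Ioo (0 : ℝ) 1, schattenNorm 1 (T s)) < ⊤ := by
  obtain ⟨T, hT, hTi, hTs, hTsi⟩ := hB.integrable
  obtain ⟨a, b, -, -, hab⟩ := hB.relBounded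
  obtain ⟨M, ω, hUg⟩ := hU.isC0Semigroup.exists_hasGrowth
    fun t ht => (hU.isSchatten t ht).isCompactOperator
  exact ⟨T, M, ω, a, b, ⟨hU.isC0Semigroup, hUg, hA, hB.domain_eq, hab, hT, hTi⟩, hTs, hTsi⟩

theorem IsPerturbation.dense_add (h : IsPerturbation A B U T M ω a b)
    (hV : IsGenerator (A + B) V) : Dense {x | ∃ y, HasGenValue V x y} := by
  refine (h.hasGrowth.dense h.isC0Semigroup).mono ?_
  rintro x ⟨y, hy⟩
  have hA : (x, y) ∈ A.graph := h.isGenerator.mem_graph_iff.2 hy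
  have hx : x ∈ B.domain := h.domain_eq ▸ LinearPMap.mem_domain_of_mem_graph hA
  obtain ⟨w, hw⟩ := LinearPMap.mem_domain_iff.1 hx
  exact ⟨y + w, hV.mem_graph_iff.1 (mem_graph_add_iff.2 ⟨y, w, hA, hw, rfl⟩)⟩

end Asymptotic

end GibbsPerturbation

theorem theorem6p6 {H : Type*} [NormedAddCommGroup H] [InnerProductSpace ℂ H] [CompleteSpace H]
    [TopologicalSpace.SeparableSpace H]
    (A B : H →ₗ.[ℂ] H) (U : ℝ → H →L[ℂ] H)
    (hU : GibbsPerturbation.IsGibbsSemigroup U)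
    (hA : GibbsPerturbation.IsGenerator A U)
    (hB : GibbsPerturbation.MemClass 1 A U B) :
    (∃ V : ℝ → H →L[ℂ] H,
      GibbsPerturbation.IsC0Semigroup V ∧ GibbsPerturbation.IsGenerator (A + B) V) ∧
    ∀ V : ℝ → H →L[ℂ] H,
      GibbsPerturbation.IsC0Semigroup V → GibbsPerturbation.IsGenerator (A + B) V →
        GibbsPerturbation.IsGibbsSemigroup V ∧
        (fun t : ℝ => GibbsPerturbation.traceNorm (V t)) ~[𝓝[>] 0]
          (fun t : ℝ => GibbsPerturbation.traceNorm (U t)) := by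
  open GibbsPerturbation in
  obtain ⟨T, M, ω, a, b, h, hTs, hTsi⟩ := MemClass.exists_isPerturbation hU hA hB
  obtain ⟨V₀, hV₀, hgen, hV₀c, hV₀U⟩ := h.exists_semigroup
  refine ⟨⟨V₀, hV₀, hgen⟩, fun V hV hVgen => ?_⟩
  have hVV₀ : ∀ t, 0 ≤ t → V t = V₀ t := fun t ht =>
    hV.eq_of_hasGenValue_imp hV₀
      (fun x y hxy => hVgen.mem_graph_iff.1 (hgen.mem_graph_iff.2 hxy)) (h.dense_add hgen) ht
  obtain ⟨C, -, hC⟩ := hV₀.exists_norm_le 1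
  have hdiff : ∀ t, 0 < t → t ≤ 1 → IsCompactOperator ⇑(V₀ t - U t : H →L[ℂ] H) ∧
      schattenNorm 1 (V₀ t - U t) ≤
        ENNReal.ofReal C * ∫⁻ s in Set.Ioo 0 t, schattenNorm 1 (T s) := fun t ht ht1 =>
    schattenNorm_sub_le_of_volterra h.continuousOn h.lintegral_lt_top hTs hV₀c hC hV₀U ht ht1
  have hs1 : ∀ t, 0 < t → t ≤ 1 → IsSchatten 1 (V t) := by
    intro t ht ht1
    have h1 := schattenNorm_add_le (hdiff t ht ht1).1 (hU.isSchatten t ht).isCompactOperator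
    rw [sub_add_cancel, ← hVV₀ t ht.le] at h1
    refine h1.trans_lt (ENNReal.add_lt_top.2 ⟨?_, hU.isSchatten t ht⟩)
    rw [hVV₀ t ht.le]
    refine (hdiff t ht ht1).2.trans_lt (ENNReal.mul_lt_top ENNReal.ofReal_lt_top ?_)
    exact (lintegral_mono_set (Set.Ioo_subset_Ioo_right ht1)).trans_lt hTsi
  have hs : ∀ t, 0 < t → IsSchatten 1 (V t) := by
    intro t ht
    rcases le_total t 1 with ht1 | ht1
    · exact hs1 t ht ht1
    · have h1 := hs1 1 one_pos le_rfl
      rw [show t = (t - 1) + 1 by ring, hV.map_add_mul (by linarith) zero_le_one]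
      exact (schattenNorm_mul_le h1.isCompactOperator _).trans_lt
        (ENNReal.mul_lt_top enorm_lt_top h1)
  refine ⟨⟨hV, hs⟩, traceNorm_isEquivalent hU hs ?_⟩
  have hlim : Tendsto (fun t => ENNReal.ofReal C * ∫⁻ s in Set.Ioo 0 t, schattenNorm 1 (T s)
      ∂(volume.restrict (Set.Ioo 0 1))) (𝓝[>] 0) (𝓝 0) := by
    have hvol : Tendsto (⇑(volume.restrict (Set.Ioo (0 : ℝ) 1)) ∘ fun t => Set.Ioo 0 t)
        (𝓝[>] 0) (𝓝 0) := by
      have h2 : Tendsto (fun t : ℝ => ENNReal.ofReal t) (𝓝[>] 0) (𝓝 0) := by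
        simpa using (ENNReal.continuous_ofReal.tendsto 0).mono_left nhdsWithin_le_nhds
      refine tendsto_of_tendsto_of_tendsto_of_le_of_le tendsto_const_nhds h2
        (fun _ => zero_le) fun t => ?_
      refine (Measure.restrict_apply_le _ _).trans ?_
      rw [Real.volume_Ioo, sub_zero]
    simpa using ENNReal.Tendsto.const_mul (tendsto_setLIntegral_zero hTsi.ne hvol)
      (Or.inr ENNReal.ofReal_ne_top)
  refine tendsto_of_tendsto_of_tendsto_of_le_of_le' tendsto_const_nhds hlim
    (Eventually.of_forall fun _ => zero_le) ?_
  filter_upwards [Ioc_mem_nhdsGT one_pos] with t ht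
  rw [hVV₀ t ht.1.le, Measure.restrict_restrict measurableSet_Ioo,
    Set.inter_eq_left.2 (Set.Ioo_subset_Ioo_right ht.2)]
  exact (hdiff t ht.1 ht.2).2
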